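/- Let $V$ be a separable real Hilbert space and let $A$ be a densely defined operator in $V$ such that $-A$ is symmetric, strictly positive and has a compact inverse; let $S$ be the (automatically analytic) strongly continuous semigroup generated by $A$, and let $(e_i)_i$ be an orthonormal basis of $V$ consisting of eigenelements of $-A$. Let $L_2(V)$ be the space of Hilbert–Schmidt operators on $V$. Let $F:V\to V$ be continuous with $\|F(x)\|\le c_F+L_F\|x\|$ for all $x\in V$, and let $G:V\to L_2(V)$ be Lipschitz continuous. Let $1/2<\beta<\beta'<1$, $1-\beta'<\alpha<\beta$ and $T>0$. Let $C^{\beta}([0,T],V)$ be the space of functions with finite norm $\sup_{s}\|u(s)\|+\sup_{0\le s<t\le T}\frac{\|u(t)-u(s)\|}{(t-s)^\beta}$ (similarly for $\beta'$), and $C^\beta_\beta([0,T],V)$ the space of continuous functions $u:[0,T]\to V$ with finite norm $\sup_s\|u(s)\|+\sup_{0<s<t\le T}s^\beta\frac{\|u(t)-u(s)\|}{(t-s)^\beta}$. Integrals against $\omega$ are defined by $$\int_s^t g\,d\omega:=(-1)^\alpha\sum_j\Big(\sum_i\int_s^t D^\alpha_{s+}(e_j,g(\cdot)e_i)[r]\;D^{1-\alpha}_{t-}(e_i,\omega(\cdot))_{t-}[r]\,dr\Big)e_j,$$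 where $$D^\alpha_{s+}f[r]=\frac1{\Gamma(1-\alpha)}\Big(\frac{f(r)}{(r-s)^\alpha}+\alpha\int_s^r\frac{f(r)-f(q)}{(r-q)^{1+\alpha}}dq\Big),$$ $$D^{1-\alpha}_{t-}w_{t-}[r]=\frac{(-1)^{1-\alpha}}{\Gamma(\alpha)}\Big(\frac{w(r)-w(t)}{(t-r)^{1-\alpha}}+(1-\alpha)\int_r^t\frac{w(r)-w(q)}{(q-r)^{2-\alpha}}dq\Big),$$ with $(-1)^\alpha(-1)^{1-\alpha}=-1$. Put $$\mathcal T^I(u,\omega)(t)=\int_0^tS(t-r)F(u(r))\,dr+\int_0^tS(t-r)G(u(r))\,d\omega(r),\qquad \mathcal T(u,\omega,u_0)(t)=S(t)u_0+\mathcal T^I(u,\omega)(t).$$ For $R\in\mathbb R$ let $B$ and $\hat B$ be the closed balls with radius $R$ and center $0$ in $C^\beta_\beta([0,T],V)$ and $C^{\beta'}([0,T],V)$, respectively, and let $\mathcal K\subset V$ be compact. Then for all $u\in B$, $\omega\in\hat B$, $t\in[0,T]$ the integrals and series above are well defined; $\mathcal T^I(B,\hat B)$ is contained and relatively compact in $C^\beta([0,T],V)$;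 and $\mathcal T(B,\hat B,\mathcal K)$ is contained and relatively compact in $C^\beta_\beta([0,T],V)$. -/

import Mathlib

open Set Filter Topology MeasureTheory

noncomputable section

/-! ### Hölder spaces on `[0, T]` -/

section HolderSpaces

variable {V : Type*} [NormedAddCommGroup V]

/-- The weighted difference quotient `s ^ κ * ‖u t - u s‖ / (t - s) ^ β` of a pair `s < t` of
points of `[0, T]`. For `κ = 0` the weight is `1` (also at `s = 0`); for `κ = β > 0` the weight is
`s ^ β`, and the pairs with `s = 0` contribute `0`. -/
def holderQuotient {T : ℝ} (β κ : ℝ) (u : C(Icc (0 : ℝ) T, V))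
    (p : {p : Icc (0 : ℝ) T × Icc (0 : ℝ) T // p.1 < p.2}) : ℝ :=
  (p.1.1 : ℝ) ^ κ * (‖u p.1.2 - u p.1.1‖ / ((p.1.2 : ℝ) - p.1.1) ^ β)

/-- The (weighted) Hölder seminorm `sup_{s < t} s ^ κ * ‖u t - u s‖ / (t - s) ^ β`. -/
def holderSeminorm {T : ℝ} (β κ : ℝ) (u : C(Icc (0 : ℝ) T, V)) : ℝ :=
  ⨆ p, holderQuotient β κ u p

theorem holderQuotient_nonneg {T : ℝ} (β κ : ℝ) (u : C(Icc (0 : ℝ) T, V))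
    (p : {p : Icc (0 : ℝ) T × Icc (0 : ℝ) T // p.1 < p.2}) : 0 ≤ holderQuotient β κ u p := by
  have h0 : (0 : ℝ) ≤ p.1.1 := p.1.1.2.1
  have h1 : (0 : ℝ) ≤ (p.1.2 : ℝ) - p.1.1 := sub_nonneg.2 (le_of_lt p.2)
  unfold holderQuotient
  positivity

theorem holderQuotient_add_le {T : ℝ} (β κ : ℝ) (u v : C(Icc (0 : ℝ) T, V))
    (p : {p : Icc (0 : ℝ) T × Icc (0 : ℝ) T // p.1 < p.2}) :
    holderQuotient β κ (u + v) p ≤ holderQuotient β κ u p + holderQuotient β κ v p := by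
  have h0 : (0 : ℝ) ≤ p.1.1 := p.1.1.2.1
  have h1 : (0 : ℝ) ≤ (p.1.2 : ℝ) - p.1.1 := sub_nonneg.2 (le_of_lt p.2)
  unfold holderQuotient
  rw [← mul_add, ← add_div]
  gcongr
  rw [ContinuousMap.add_apply, ContinuousMap.add_apply, add_sub_add_comm]
  exact norm_add_le _ _

theorem holderQuotient_smul [NormedSpace ℝ V] {T : ℝ} (β κ c : ℝ) (u : C(Icc (0 : ℝ) T, V))
    (p : {p : Icc (0 : ℝ) T × Icc (0 : ℝ) T // p.1 < p.2}) :
    holderQuotient β κ (c • u) p = |c| * holderQuotient β κ u p := by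
  unfold holderQuotient
  rw [ContinuousMap.smul_apply, ContinuousMap.smul_apply, ← smul_sub, norm_smul, Real.norm_eq_abs]
  ring

theorem holderQuotient_zero {T : ℝ} (β κ : ℝ)
    (p : {p : Icc (0 : ℝ) T × Icc (0 : ℝ) T // p.1 < p.2}) :
    holderQuotient β κ (0 : C(Icc (0 : ℝ) T, V)) p = 0 := by
  simp [holderQuotient]

theorem holderQuotient_neg {T : ℝ} (β κ : ℝ) (u : C(Icc (0 : ℝ) T, V))
    (p : {p : Icc (0 : ℝ) T × Icc (0 : ℝ) T // p.1 < p.2}) :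
    holderQuotient β κ (-u) p = holderQuotient β κ u p := by
  simp only [holderQuotient, ContinuousMap.neg_apply, neg_sub_neg]
  rw [norm_sub_rev]

/-- The continuous functions `[0, T] → V` with finite (weighted) Hölder seminorm. -/
def holderSubmodule (T β κ : ℝ) (V : Type*) [NormedAddCommGroup V] [NormedSpace ℝ V] :
    Submodule ℝ C(Icc (0 : ℝ) T, V) where
  carrier := {u | BddAbove (range (holderQuotient β κ u))}
  add_mem' := by
    rintro u v ⟨a, ha⟩ ⟨b, hb⟩
    refine ⟨a + b, ?_⟩
    rintro _ ⟨p, rfl⟩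
    exact (holderQuotient_add_le β κ u v p).trans (add_le_add (ha ⟨p, rfl⟩) (hb ⟨p, rfl⟩))
  zero_mem' := by
    refine ⟨0, ?_⟩
    rintro _ ⟨p, rfl⟩
    exact (holderQuotient_zero β κ p).le
  smul_mem' := by
    rintro c u ⟨a, ha⟩
    refine ⟨|c| * a, ?_⟩
    rintro _ ⟨p, rfl⟩
    rw [holderQuotient_smul]
    exact mul_le_mul_of_nonneg_left (ha ⟨p, rfl⟩) (abs_nonneg c)

/-- The space of continuous functions `u : [0, T] → V` with finite norm
`sup_s ‖u s‖ + sup_{s < t} s ^ κ * ‖u t - u s‖ / (t - s) ^ β`. It carries that norm, not the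
supremum norm. -/
def WeightedHolderSpace (T β κ : ℝ) (V : Type*) [NormedAddCommGroup V] [NormedSpace ℝ V] : Type _ :=
  holderSubmodule T β κ V

/-- The Hölder space `C^β([0, T], V)`. -/
abbrev HolderSpace (T β : ℝ) (V : Type*) [NormedAddCommGroup V] [NormedSpace ℝ V] : Type _ :=
  WeightedHolderSpace T β 0 V

/-- The space `C^β_β([0, T], V)`, whose seminorm carries the weight `s ^ β`. -/
abbrev SingularHolderSpace (T β : ℝ) (V : Type*) [NormedAddCommGroup V] [NormedSpace ℝ V] :
    Type _ :=
  WeightedHolderSpace T β β V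

/-- The norm `sup_s ‖u s‖ + sup_{s < t} s ^ κ * ‖u t - u s‖ / (t - s) ^ β`. -/
def weightedHolderNorm (T β κ : ℝ) (V : Type*) [NormedAddCommGroup V] [NormedSpace ℝ V] :
    AddGroupNorm (holderSubmodule T β κ V) where
  toFun u := ‖(u : C(Icc (0 : ℝ) T, V))‖ + holderSeminorm β κ (u : C(Icc (0 : ℝ) T, V))
  map_zero' := by
    simp [holderSeminorm, holderQuotient_zero]
  add_le' u v := by
    have h1 := norm_add_le (u : C(Icc (0 : ℝ) T, V)) (v : C(Icc (0 : ℝ) T, V))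
    have h2 : holderSeminorm β κ ((u : C(Icc (0 : ℝ) T, V)) + (v : C(Icc (0 : ℝ) T, V))) ≤
        holderSeminorm β κ (u : C(Icc (0 : ℝ) T, V)) +
          holderSeminorm β κ (v : C(Icc (0 : ℝ) T, V)) := by
      refine Real.iSup_le (fun p => (holderQuotient_add_le β κ _ _ p).trans ?_) ?_
      · exact add_le_add (le_ciSup u.2 p) (le_ciSup v.2 p)
      · exact add_nonneg (Real.iSup_nonneg (holderQuotient_nonneg β κ _))
          (Real.iSup_nonneg (holderQuotient_nonneg β κ _))
    rw [Submodule.coe_add]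
    linarith
  neg' u := by
    simp [holderSeminorm, holderQuotient_neg]
  eq_zero_of_map_eq_zero' u hu := by
    have h1 : 0 ≤ holderSeminorm β κ (u : C(Icc (0 : ℝ) T, V)) :=
      Real.iSup_nonneg (holderQuotient_nonneg β κ _)
    have h2 := norm_nonneg (u : C(Icc (0 : ℝ) T, V))
    have h3 : ‖(u : C(Icc (0 : ℝ) T, V))‖ = 0 := le_antisymm (by linarith) h2
    exact Subtype.ext (norm_eq_zero.1 h3)

instance WeightedHolderSpace.instNormedAddCommGroup (T β κ : ℝ) (V : Type*)
    [NormedAddCommGroup V] [NormedSpace ℝ V] : NormedAddCommGroup (WeightedHolderSpace T β κ V) :=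
  (weightedHolderNorm T β κ V).toNormedAddCommGroup

/-- The underlying continuous function on `[0, T]`. -/
def WeightedHolderSpace.toContinuousMap [NormedSpace ℝ V] {T β κ : ℝ} (u : WeightedHolderSpace T β κ V) :
    C(Icc (0 : ℝ) T, V) :=
  u.1

/-- The path of `u`, extended constantly outside `[0, T]` (the extension plays no role for the
values on `[0, T]`, which are the only ones that are used). -/
def WeightedHolderSpace.path [NormedSpace ℝ V] {T β κ : ℝ} (hT : 0 ≤ T)
    (u : WeightedHolderSpace T β κ V) : ℝ → V :=
  IccExtend hT u.toContinuousMap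

end HolderSpaces

/-! ### The operator `A` and its semigroup -/

section Operators

variable {V : Type*} [NormedAddCommGroup V] [InnerProductSpace ℝ V]

/-- `-A` is a densely defined, strictly positive, symmetric operator with a compact inverse. -/
structure IsNegPosSymmCompactInv (A : V →ₗ.[ℝ] V) : Prop where
  dense : Dense (A.domain : Set V)
  symm : ∀ x y : A.domain, inner ℝ (A x) (y : V) = inner ℝ (x : V) (A y)
  pos : ∀ x : A.domain, x ≠ 0 → 0 < inner ℝ (-(A x)) (x : V)
  compact_inv : ∃ K : V →L[ℝ] V, IsCompactOperator K ∧
    (∀ v : V, ∃ h : K v ∈ A.domain, -(A ⟨K v, h⟩) = v) ∧ ∀ x : A.domain, K (-(A x)) = x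

/-- `S` (on `[0, ∞)`) is the strongly continuous semigroup of bounded operators whose infinitesimal
generator is `A`, including the domain of the generator. -/
structure IsSemigroupGeneratedBy (S : ℝ → V →L[ℝ] V) (A : V →ₗ.[ℝ] V) : Prop where
  zero : S 0 = ContinuousLinearMap.id ℝ V
  add : ∀ s t : ℝ, 0 ≤ s → 0 ≤ t → S (s + t) = (S s).comp (S t)
  continuousOn : ∀ v : V, ContinuousOn (fun t => S t v) (Ici 0)
  generator : ∀ x y : V, (∃ h : x ∈ A.domain, A ⟨x, h⟩ = y) ↔
    Tendsto (fun t : ℝ => t⁻¹ • (S t x - x)) (𝓝[>] 0) (𝓝 y)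

/-- `e` consists of eigenelements of `-A`, with eigenvalues `lam`. -/
def IsEigenbasis {ι : Type*} (e : HilbertBasis ι ℝ V) (lam : ι → ℝ) (A : V →ₗ.[ℝ] V) : Prop :=
  ∀ i, ∃ h : e i ∈ A.domain, -(A ⟨e i, h⟩) = lam i • e i

/-- `L` is a Hilbert-Schmidt operator, that is, an element of `L_2(V)`. -/
def IsHilbertSchmidt {ι : Type*} (e : HilbertBasis ι ℝ V) (L : V →L[ℝ] V) : Prop :=
  Summable fun i => ‖L (e i)‖ ^ 2

/-- The Hilbert-Schmidt norm. -/
def hilbertSchmidtNorm {ι : Type*} (e : HilbertBasis ι ℝ V) (L : V →L[ℝ] V) : ℝ :=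
  √(∑' i, ‖L (e i)‖ ^ 2)

end Operators

/-! ### Fractional derivatives and the pathwise integral -/

/-- The integrand of the singular integral in the left sided fractional derivative. -/
def leftFracKernel (α : ℝ) (f : ℝ → ℝ) (r q : ℝ) : ℝ :=
  (f r - f q) / (r - q) ^ (1 + α)

/-- The left sided fractional derivative `D_{s+}^α f [r]`. -/
def leftFracDeriv (α s : ℝ) (f : ℝ → ℝ) (r : ℝ) : ℝ :=
  1 / Real.Gamma (1 - α) * (f r / (r - s) ^ α + α * ∫ q in s..r, leftFracKernel α f r q)

/-- The integrand of the singular integral in the right sided fractional derivative. -/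
def rightFracKernel (α : ℝ) (w : ℝ → ℝ) (r q : ℝ) : ℝ :=
  (w r - w q) / (q - r) ^ (2 - α)

/-- The right sided fractional derivative `D_{t-}^{1-α} w_{t-} [r]` of `w_{t-} = w - w t`, up to its
constant phase `(-1) ^ (1 - α)`, which is accounted for in `pathwiseIntegral`. -/
def rightFracDeriv (α t : ℝ) (w : ℝ → ℝ) (r : ℝ) : ℝ :=
  1 / Real.Gamma α *
    ((w r - w t) / (t - r) ^ (1 - α) + (1 - α) * ∫ q in r..t, rightFracKernel α w r q)

/-- The two phases in the definition of the pathwise integral multiply to `-1`. -/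
theorem phase_mul_phase (α : ℝ) : (-1 : ℂ) ^ (α : ℂ) * (-1 : ℂ) ^ (1 - α : ℂ) = -1 := by
  rw [← Complex.cpow_add _ _ (by norm_num)]
  simp

section PathwiseIntegral

variable {V : Type*} [NormedAddCommGroup V] [InnerProductSpace ℝ V] {ι : Type*}

/-- The integrand of the `(j, i)` entry of the pathwise integral:
`D_{s+}^α (e_j, g e_i) [r] * D_{t-}^{1-α} (e_i, ω)_{t-} [r]`, without phase. -/
def pathwiseIntegrand (e : HilbertBasis ι ℝ V) (α s t : ℝ) (g : ℝ → V →L[ℝ] V) (ω : ℝ → V)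
    (j i : ι) (r : ℝ) : ℝ :=
  leftFracDeriv α s (fun q => inner ℝ (e j) (g q (e i))) r *
    rightFracDeriv α t (fun q => inner ℝ (e i) (ω q)) r

/-- The integral `∫_s^t g dω = (-1)^α ∑_j (∑_i ∫_s^t D_{s+}^α (e_j, g e_i) [r]
D_{t-}^{1-α} (e_i, ω)_{t-} [r] dr) e_j`. The leading sign is the product of the phases `(-1)^α` and
`(-1)^(1-α)`, see `phase_mul_phase`. -/
def pathwiseIntegral (e : HilbertBasis ι ℝ V) (α s t : ℝ) (g : ℝ → V →L[ℝ] V) (ω : ℝ → V) : V :=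
  -∑' j, (∑' i, ∫ r in s..t, pathwiseIntegrand e α s t g ω j i r) • e j

/-- All integrals and series in `pathwiseIntegral` exist. -/
structure PathwiseIntegrable (e : HilbertBasis ι ℝ V) (α s t : ℝ) (g : ℝ → V →L[ℝ] V)
    (ω : ℝ → V) : Prop where
  left : ∀ j i, ∀ᵐ r, r ∈ Ioo s t →
    IntervalIntegrable (leftFracKernel α (fun q => inner ℝ (e j) (g q (e i))) r) volume s r
  right : ∀ i, ∀ᵐ r, r ∈ Ioo s t →
    IntervalIntegrable (rightFracKernel α (fun q => inner ℝ (e i) (ω q)) r) volume r t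
  integrable : ∀ j i, IntervalIntegrable (pathwiseIntegrand e α s t g ω j i) volume s t
  summable_inner : ∀ j, Summable fun i => ∫ r in s..t, pathwiseIntegrand e α s t g ω j i r
  summable_outer : Summable fun j => (∑' i, ∫ r in s..t, pathwiseIntegrand e α s t g ω j i r) • e j

/-- `𝒯^I(u, ω)(t) = ∫_0^t S(t-r) F(u(r)) dr + ∫_0^t S(t-r) G(u(r)) dω`. -/
def mildIntegralOp (e : HilbertBasis ι ℝ V) (α : ℝ) (S : ℝ → V →L[ℝ] V) (F : V → V)
    (G : V → V →L[ℝ] V) (u ω : ℝ → V) (t : ℝ) : V :=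
  (∫ r in (0 : ℝ)..t, S (t - r) (F (u r))) +
    pathwiseIntegral e α 0 t (fun r => (S (t - r)).comp (G (u r))) ω

/-- The two integrals in `mildIntegralOp` are well defined. -/
def MildIntegrable (e : HilbertBasis ι ℝ V) (α : ℝ) (S : ℝ → V →L[ℝ] V) (F : V → V)
    (G : V → V →L[ℝ] V) (u ω : ℝ → V) (t : ℝ) : Prop :=
  IntervalIntegrable (fun r => S (t - r) (F (u r))) volume 0 t ∧
    PathwiseIntegrable e α 0 t (fun r => (S (t - r)).comp (G (u r))) ω

/-- `𝒯(u, ω, u₀)(t) = S(t) u₀ + ∫_0^t S(t-r) F(u(r)) dr + ∫_0^t S(t-r) G(u(r)) dω`. -/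
def mildOp (e : HilbertBasis ι ℝ V) (α : ℝ) (S : ℝ → V →L[ℝ] V) (F : V → V)
    (G : V → V →L[ℝ] V) (u ω : ℝ → V) (u₀ : V) (t : ℝ) : V :=
  S t u₀ + mildIntegralOp e α S F G u ω t

end PathwiseIntegral

end

open Set Filter Topology MeasureTheory

noncomputable section

/-! ### Hilbert bases -/

section HilbertBasis

variable {V : Type*} [NormedAddCommGroup V] [InnerProductSpace ℝ V] {ι : Type*}

/-! The operators `T^I(u, ω)` gain slightly more time regularity than `C^β` asks for, together with
compactness in space; both gains are uniform over the balls, so Arzelà–Ascoli and interpolation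
finish.

The semigroup is diagonal in the eigenbasis. Scalar bounds on exponentials, uniform in the
eigenvalue, make it contractive, give `‖S (h + s) - S s‖ ≤ h ^ δ * s ^ (-δ)`, and make it compact at
positive times (`IsSmoothingSemigroup`). Nothing else about `A` is used afterwards.

The coordinatewise pathwise integral is, up to sign, one Bochner integral of the operator valued
derivative applied to the vector valued one (`FracIntegrable.pathwiseIntegral_eq`). Operator norms
suffice for this, so the Hilbert–Schmidt norm of `G` enters only as an upper bound. Hence `T^I` is a
convolution with `F` minus `fracConv`.

For `J = T^I(u, ω)` and some `δ` strictly between `β` and `β'`, both the increments of `J` and the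
distances `‖S h (J t) - J t‖` are of order `δ` (`HasOrbitRegularity`); the second bound replaces
membership in the domain of a fractional power of `-A`. The delicate point is that the right sided
derivative depends on the terminal time: `fracConv_sub` isolates this memory term, and
`norm_rightFracDerivVec_sub_le` and `norm_integral_memory_le` control it.

Since `S h` is compact, bounded vectors with a uniform rate `S h v → v` form a compact set
(`isCompact_setOf_semigroup_approx`), so all paths take values in one compact set. For `T`, the
orbits `S(·)u₀` depend continuously on `u₀` in `C^β_β`, the weight absorbing their singularity at
time zero, and the image lies in a continuous image of a product of compact sets. -/

theorem HilbertBasis.countable [TopologicalSpace.SeparableSpace V] (e : HilbertBasis ι ℝ V) :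
    Countable ι := by
  -- Distinct basis vectors are `√2` apart, so the balls of radius `1/2` are disjoint. Countability
  -- later permits exchanging the sum over the basis with the integral.
  refine Pairwise.countable_of_isOpen_disjoint (s := fun i => Metric.ball (e i) (1 / 2))
    (fun i j hij => ?_) (fun i => Metric.isOpen_ball) (fun i => ⟨e i, by simp⟩)
  refine Metric.ball_disjoint_ball ?_
  have h : ‖e i - e j‖ ^ 2 = 2 := by
    rw [norm_sub_sq_real, e.orthonormal.1 i, e.orthonormal.1 j, e.orthonormal.2 hij]
    norm_num
  rw [dist_eq_norm]
  nlinarith [norm_nonneg (e i - e j)]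

theorem HilbertBasis.hasSum_inner_sq (e : HilbertBasis ι ℝ V) (x : V) :
    HasSum (fun i => inner ℝ (e i) x ^ 2) (‖x‖ ^ 2) := by
  have h := e.hasSum_inner_mul_inner x x
  rw [real_inner_self_eq_norm_sq] at h
  refine h.congr_fun fun i => ?_
  rw [real_inner_comm x (e i), sq]

theorem HilbertBasis.clm_ext {E : Type*} [NormedAddCommGroup E] [NormedSpace ℝ E]
    (e : HilbertBasis ι ℝ V) {f g : V →L[ℝ] E} (h : ∀ i, f (e i) = g (e i)) : f = g := by
  refine ContinuousLinearMap.ext_on (s := range e) ?_ ?_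
  · exact Submodule.dense_iff_topologicalClosure_eq_top.2 e.dense_span
  · rintro _ ⟨i, rfl⟩
    exact h i

/-- A bounded operator that is diagonal in an orthonormal basis is bounded by its eigenvalues. -/
theorem HilbertBasis.opNorm_le_of_diagonal (e : HilbertBasis ι ℝ V) {L : V →L[ℝ] V} {m : ι → ℝ}
    (hL : ∀ i, L (e i) = m i • e i) {C : ℝ} (hC : 0 ≤ C) (hm : ∀ i, |m i| ≤ C) : ‖L‖ ≤ C := by
  classical
  refine L.opNorm_le_bound hC fun v => ?_
  have h1 : ∀ i, inner ℝ (e i) (L v) = m i * inner ℝ (e i) v := by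
    intro i
    have : (innerSL ℝ (e i)).comp L = m i • innerSL ℝ (e i) := by
      refine e.clm_ext fun j => ?_
      simp only [ContinuousLinearMap.comp_apply, hL, innerSL_apply_apply,
        _root_.smul_apply, inner_smul_right, smul_eq_mul,
        orthonormal_iff_ite.1 e.orthonormal]
      split_ifs with hij
      · rw [hij]
      · simp
    simpa using congrArg (fun f => f v) this
  have h2 := e.hasSum_inner_sq (L v)
  have h3 := (e.hasSum_inner_sq v).mul_left (C ^ 2)
  have h4 : ‖L v‖ ^ 2 ≤ C ^ 2 * ‖v‖ ^ 2 := by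
    refine hasSum_le (fun i => ?_) h2 h3
    rw [h1, mul_pow]
    exact mul_le_mul_of_nonneg_right (sq_le_sq.2 ((hm i).trans (le_abs_self C))) (sq_nonneg _)
  rw [← mul_pow] at h4
  exact le_of_sq_le_sq h4 (by positivity)

/-- The coordinates of `L* w` are the products `(L e_i, w)`, so Parseval and Cauchy–Schwarz bound
the adjoint, which has the same norm. -/
theorem opNorm_le_hilbertSchmidtNorm [CompleteSpace V] (e : HilbertBasis ι ℝ V) {L : V →L[ℝ] V}
    (hL : IsHilbertSchmidt e L) : ‖L‖ ≤ hilbertSchmidtNorm e L := by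
  have h0 : (0 : ℝ) ≤ hilbertSchmidtNorm e L := Real.sqrt_nonneg _
  rw [← (ContinuousLinearMap.adjoint (𝕜 := ℝ) (E := V) (F := V)).norm_map L]
  refine ContinuousLinearMap.opNorm_le_bound _ h0 fun w => ?_
  have h1 := e.hasSum_inner_sq (ContinuousLinearMap.adjoint L w)
  have h2 : ‖ContinuousLinearMap.adjoint L w‖ ^ 2 ≤ (∑' i, ‖L (e i)‖ ^ 2) * ‖w‖ ^ 2 := by
    refine hasSum_le (fun i => ?_) h1 (hL.hasSum.mul_right (‖w‖ ^ 2))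
    rw [ContinuousLinearMap.adjoint_inner_right, ← mul_pow, ← sq_abs]
    gcongr
    exact abs_real_inner_le_norm _ _
  have h3 : (∑' i, ‖L (e i)‖ ^ 2) = hilbertSchmidtNorm e L ^ 2 :=
    (Real.sq_sqrt (tsum_nonneg fun i => by positivity)).symm
  rw [h3, ← mul_pow] at h2
  exact le_of_sq_le_sq h2 (by positivity)

/-- Summability of the difference is essential: `hilbertSchmidtNorm` takes the value `0` on
operators that are not Hilbert–Schmidt, and the Lipschitz bound on `G` would then say nothing. -/
theorem IsHilbertSchmidt.sub {e : HilbertBasis ι ℝ V} {L M : V →L[ℝ] V}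
    (hL : IsHilbertSchmidt e L) (hM : IsHilbertSchmidt e M) : IsHilbertSchmidt e (L - M) := by
  refine Summable.of_nonneg_of_le (fun i => by positivity) (fun i => ?_)
    ((hL.mul_left 2).add (hM.mul_left 2))
  rw [_root_.sub_apply]
  have h := norm_sub_le (L (e i)) (M (e i))
  nlinarith [norm_nonneg (L (e i) - M (e i)), sq_nonneg (‖L (e i)‖ - ‖M (e i)‖)]

end HilbertBasis

/-! ### The semigroup -/

/-- The properties of the semigroup that matter for mild solutions: contractivity, the smoothing
estimate of an analytic semigroup, and compactness at positive times. -/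
structure IsSmoothingSemigroup {V : Type*} [NormedAddCommGroup V] [NormedSpace ℝ V]
    (S : ℝ → V →L[ℝ] V) : Prop where
  zero : S 0 = ContinuousLinearMap.id ℝ V
  add : ∀ s t : ℝ, 0 ≤ s → 0 ≤ t → S (s + t) = (S s).comp (S t)
  continuousOn : ∀ v : V, ContinuousOn (fun t => S t v) (Ici 0)
  norm_le_one : ∀ t, 0 ≤ t → ‖S t‖ ≤ 1
  smoothing : ∀ δ h s : ℝ, 0 ≤ δ → δ ≤ 1 → 0 ≤ h → 0 < s → ‖S (h + s) - S s‖ ≤ h ^ δ * s ^ (-δ)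
  compact : ∀ t, 0 < t → IsCompactOperator (S t)

section Semigroup

variable {V : Type*} [NormedAddCommGroup V] [InnerProductSpace ℝ V] {ι : Type*}
  {A : V →ₗ.[ℝ] V} {S : ℝ → V →L[ℝ] V} {e : HilbertBasis ι ℝ V} {lam : ι → ℝ}

theorem IsEigenbasis.pos (hA : IsNegPosSymmCompactInv A) (he : IsEigenbasis e lam A) (i : ι) :
    0 < lam i := by
  obtain ⟨h, hi⟩ := he i
  have h0 : e i ≠ 0 := e.orthonormal.ne_zero i
  have := hA.pos ⟨e i, h⟩ (fun h' => h0 (congrArg Subtype.val h'))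
  rw [hi, inner_smul_left, real_inner_self_eq_norm_sq, e.orthonormal.1 i] at this
  simpa using this

/-- The path `exp (λ r) S(r) e_i` is continuous with vanishing right derivative, hence constant. The
generator is a one-sided limit, so only right derivatives are available. -/
theorem IsSemigroupGeneratedBy.apply_eigenvector (hS : IsSemigroupGeneratedBy S A)
    (he : IsEigenbasis e lam A) (i : ι) {t : ℝ} (ht : 0 ≤ t) :
    S t (e i) = Real.exp (-(lam i * t)) • e i := by
  obtain ⟨h, hi⟩ := he i
  have hlim : Tendsto (fun t : ℝ => t⁻¹ • (S t (e i) - e i)) (𝓝[>] 0) (𝓝 (-(lam i) • e i)) :=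
    (hS.generator _ _).1 ⟨h, by rw [neg_smul, ← hi, neg_neg]⟩
  have hder : ∀ x ∈ Ico 0 t, HasDerivWithinAt (fun r => S r (e i)) (-(lam i) • S x (e i))
      (Ici x) x := by
    intro x hx
    rw [hasDerivWithinAt_iff_tendsto_slope, Ici_sdiff_left]
    have h1 : Tendsto (fun r : ℝ => S x ((r - x)⁻¹ • (S (r - x) (e i) - e i))) (𝓝[>] x)
        (𝓝 (S x (-(lam i) • e i))) := by
      refine ((S x).continuous.tendsto _).comp (hlim.comp ?_)
      refine tendsto_nhdsWithin_iff.2 ⟨?_, ?_⟩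
      · have : Tendsto (fun r : ℝ => r - x) (𝓝 x) (𝓝 (x - x)) :=
          (continuous_id.sub continuous_const).tendsto x
        rw [sub_self] at this
        exact this.mono_left nhdsWithin_le_nhds
      · filter_upwards [self_mem_nhdsWithin] with r hr
        exact sub_pos.2 (show x < r from hr)
    rw [map_smul] at h1
    refine h1.congr' ?_
    filter_upwards [self_mem_nhdsWithin] with r hr
    have h2 : S r = (S x).comp (S (r - x)) := by
      rw [← hS.add x (r - x) hx.1 (sub_nonneg.2 (le_of_lt hr))]
      congr 1
      ring
    rw [slope_def_module, h2, map_smul, map_sub]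
    rfl
  have hcont : ContinuousOn (fun r => Real.exp (lam i * r) • S r (e i)) (Icc 0 t) := by
    refine ContinuousOn.smul (by fun_prop) ((hS.continuousOn (e i)).mono fun x hx => hx.1)
  have hconst := constant_of_has_deriv_right_zero hcont (fun x hx => ?_) t ⟨ht, le_rfl⟩
  · simp only [mul_zero, Real.exp_zero, one_smul, hS.zero, ContinuousLinearMap.id_apply] at hconst
    calc S t (e i) = Real.exp (-(lam i * t)) • Real.exp (lam i * t) • S t (e i) := by
          rw [smul_smul, ← Real.exp_add]
          simp
      _ = _ := by rw [hconst]
  · have h3 : HasDerivWithinAt (fun r => Real.exp (lam i * r)) (Real.exp (lam i * x) * lam i)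
        (Ici x) x := by
      have := (((hasDerivAt_id x).const_mul (lam i)).exp).hasDerivWithinAt (s := Ici x)
      simpa using this
    refine (h3.smul (hder x hx)).congr_deriv ?_
    module

theorem one_sub_exp_neg_le_rpow {x δ : ℝ} (hx : 0 ≤ x) (h0 : 0 ≤ δ) (h1 : δ ≤ 1) :
    1 - Real.exp (-x) ≤ x ^ δ := by
  rcases le_total x 1 with h | h
  · calc 1 - Real.exp (-x) ≤ x := by linarith [Real.add_one_le_exp (-x)]
      _ = x ^ (1 : ℝ) := (Real.rpow_one x).symm
      _ ≤ x ^ δ := by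
        rcases hx.eq_or_lt with rfl | hx
        · rw [Real.zero_rpow one_ne_zero]
          exact Real.rpow_nonneg le_rfl _
        · exact Real.rpow_le_rpow_of_exponent_ge hx h h1
  · exact (by linarith [Real.exp_pos (-x)] : 1 - Real.exp (-x) ≤ 1).trans (Real.one_le_rpow h h0)

theorem rpow_mul_exp_neg_le_one {x δ : ℝ} (hx : 0 ≤ x) (h0 : 0 ≤ δ) (h1 : δ ≤ 1) :
    x ^ δ * Real.exp (-x) ≤ 1 := by
  have h : x ^ δ ≤ Real.exp x := by
    rcases le_total x 1 with h | h
    · exact (Real.rpow_le_one hx h h0).trans (Real.one_le_exp hx)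
    · calc x ^ δ ≤ x ^ (1 : ℝ) := Real.rpow_le_rpow_of_exponent_le h h1
        _ = x := Real.rpow_one x
        _ ≤ Real.exp x := by linarith [Real.add_one_le_exp x]
  calc x ^ δ * Real.exp (-x) ≤ Real.exp x * Real.exp (-x) := by gcongr
    _ = 1 := by rw [← Real.exp_add]; simp

/-- Factor the difference as `(1 - exp (-lh)) exp (-ls)` and bound the first factor by `(lh) ^ δ`.
Since `(ls) ^ δ exp (-ls) ≤ 1`, the eigenvalue cancels; this uniformity is what turns it into an
operator norm bound. -/
theorem exp_sub_exp_le_rpow {l h s δ : ℝ} (hl : 0 < l) (h0 : 0 ≤ δ) (h1 : δ ≤ 1) (hh : 0 ≤ h)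
    (hs : 0 < s) :
    |Real.exp (-(l * (h + s))) - Real.exp (-(l * s))| ≤ h ^ δ * s ^ (-δ) := by
  have e1 : Real.exp (-(l * (h + s))) - Real.exp (-(l * s)) =
      -((1 - Real.exp (-(l * h))) * Real.exp (-(l * s))) := by
    rw [mul_add, neg_add, Real.exp_add]
    ring
  have h2 : 0 ≤ 1 - Real.exp (-(l * h)) := by
    have : Real.exp (-(l * h)) ≤ 1 := Real.exp_le_one_iff.2 (by have := mul_nonneg hl.le hh; linarith)
    linarith
  rw [e1, abs_neg, abs_of_nonneg (mul_nonneg h2 (Real.exp_pos _).le)]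
  calc (1 - Real.exp (-(l * h))) * Real.exp (-(l * s))
      ≤ (l * h) ^ δ * Real.exp (-(l * s)) := by
        gcongr
        exact one_sub_exp_neg_le_rpow (by positivity) h0 h1
    _ = h ^ δ * s ^ (-δ) * ((l * s) ^ δ * Real.exp (-(l * s))) := by
        rw [Real.mul_rpow hl.le hh, Real.mul_rpow hl.le hs.le, Real.rpow_neg hs.le]
        have : s ^ δ ≠ 0 := (Real.rpow_pos_of_pos hs δ).ne'
        field_simp
    _ ≤ h ^ δ * s ^ (-δ) * 1 := by
        gcongr
        exact rpow_mul_exp_neg_le_one (by positivity) h0 h1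
    _ = _ := mul_one _

/-- The scalar form of approximating `S ε` by `h⁻¹ (-A)⁻¹ (S ε - S (h + ε))`. With `x = lh` the
relative error `1 - (1 - exp (-x)) / x` lies in `[0, x]`, and the factor `exp (-lε)` makes the bound
independent of `l`. -/
theorem abs_exp_sub_div_le {l h ε : ℝ} (hl : 0 < l) (hh : 0 < h) (hε : 0 < ε) :
    |Real.exp (-(l * ε)) -
      h⁻¹ * (l⁻¹ * (Real.exp (-(l * ε)) - Real.exp (-(l * (h + ε)))))| ≤ h / ε := by
  have e1 : Real.exp (-(l * ε)) -
      h⁻¹ * (l⁻¹ * (Real.exp (-(l * ε)) - Real.exp (-(l * (h + ε))))) =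
      Real.exp (-(l * ε)) * (1 - (1 - Real.exp (-(l * h))) / (l * h)) := by
    rw [mul_add, neg_add, Real.exp_add]
    field_simp
  have hx : 0 < l * h := by positivity
  set x := l * h with hxdef
  have h2 : (1 - Real.exp (-x)) / x ≤ 1 := by
    rw [div_le_one hx]
    linarith [Real.add_one_le_exp (-x)]
  have h3 : 1 - x ≤ (1 - Real.exp (-x)) / x := by
    rw [le_div_iff₀ hx]
    have h4 : Real.exp (-x) * (1 + x) ≤ 1 := by
      calc Real.exp (-x) * (1 + x) ≤ Real.exp (-x) * Real.exp x := by
            gcongr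
            linarith [Real.add_one_le_exp x]
        _ = 1 := by rw [← Real.exp_add]; simp
    have h5 := Real.exp_pos (-x)
    have h6 : Real.exp (-x) ≤ 1 / (1 + x) := by
      rw [le_div_iff₀ (by linarith)]
      exact h4
    have h7 : 1 / (1 + x) ≤ 1 - x + x ^ 2 := by
      rw [div_le_iff₀ (by linarith)]
      nlinarith [pow_pos hx 3]
    nlinarith
  rw [e1, abs_of_nonneg (mul_nonneg (Real.exp_pos _).le (by linarith))]
  calc Real.exp (-(l * ε)) * (1 - (1 - Real.exp (-x)) / x)
      ≤ Real.exp (-(l * ε)) * x := by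
        gcongr
        linarith
    _ = h / ε * ((l * ε) ^ (1 : ℝ) * Real.exp (-(l * ε))) := by
        rw [hxdef, Real.rpow_one]
        field_simp
    _ ≤ h / ε * 1 := by
        gcongr
        exact rpow_mul_exp_neg_le_one (by positivity) zero_le_one le_rfl
    _ = h / ε := mul_one _

/-- Formally `S ε = (-A)⁻¹ (-A S ε)`. Replacing `-A S ε` by a difference quotient gives compact
operators `B h` that converge to `S ε` in norm, with no information on the growth of the
eigenvalues. -/
theorem IsSemigroupGeneratedBy.isCompactOperator [CompleteSpace V]
    (hA : IsNegPosSymmCompactInv A) (hS : IsSemigroupGeneratedBy S A)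
    (he : IsEigenbasis e lam A) {ε : ℝ} (hε : 0 < ε) : IsCompactOperator (S ε) := by
  obtain ⟨K, hK, -, hKA⟩ := hA.compact_inv
  have hKe : ∀ i, K (e i) = (lam i)⁻¹ • e i := by
    intro i
    obtain ⟨h, hi⟩ := he i
    have h1 := hKA ⟨e i, h⟩
    rw [hi, map_smul] at h1
    rw [← (show lam i • K (e i) = e i from h1), smul_smul,
      inv_mul_cancel₀ (he.pos hA i).ne', one_smul, show lam i • K (e i) = e i from h1]
  let B : ℝ → V →L[ℝ] V := fun h => h⁻¹ • (K.comp (S ε - S (h + ε)))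
  have hB : ∀ h, IsCompactOperator (B h) := fun h => (hK.comp_clm _).smul _
  refine isCompactOperator_of_tendsto (l := 𝓝[>] (0 : ℝ)) (F := B) ?_
    (Eventually.of_forall hB)
  rw [tendsto_iff_norm_sub_tendsto_zero]
  have hlim : Tendsto (fun h : ℝ => h / ε) (𝓝[>] 0) (𝓝 0) := by
    have : Tendsto (fun h : ℝ => h / ε) (𝓝 0) (𝓝 (0 / ε)) :=
      (continuous_id.div_const ε).tendsto 0
    rw [zero_div] at this
    exact this.mono_left nhdsWithin_le_nhds
  refine squeeze_zero' (Eventually.of_forall fun h => norm_nonneg _) ?_ hlim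
  filter_upwards [self_mem_nhdsWithin] with h hh
  have hh : 0 < h := hh
  rw [norm_sub_rev]
  refine e.opNorm_le_of_diagonal (m := fun i => Real.exp (-(lam i * ε)) -
      h⁻¹ * ((lam i)⁻¹ * (Real.exp (-(lam i * ε)) - Real.exp (-(lam i * (h + ε))))))
    (fun i => ?_) (by positivity) fun i => abs_exp_sub_div_le (he.pos hA i) hh hε
  simp only [B, _root_.sub_apply, _root_.smul_apply,
    ContinuousLinearMap.comp_apply, hS.apply_eigenvector he i hε.le,
    hS.apply_eigenvector he i (by positivity : 0 ≤ h + ε), map_sub, map_smul, hKe]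
  module

theorem IsSemigroupGeneratedBy.isSmoothingSemigroup [CompleteSpace V]
    (hA : IsNegPosSymmCompactInv A) (hS : IsSemigroupGeneratedBy S A)
    (he : IsEigenbasis e lam A) : IsSmoothingSemigroup S where
  zero := hS.zero
  add := hS.add
  continuousOn := hS.continuousOn
  norm_le_one t ht := by
    refine e.opNorm_le_of_diagonal (fun i => hS.apply_eigenvector he i ht) zero_le_one fun i => ?_
    rw [abs_of_pos (Real.exp_pos _), Real.exp_le_one_iff]
    have := mul_nonneg (he.pos hA i).le ht
    linarith
  smoothing δ h s h0 h1 hh hs := by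
    refine e.opNorm_le_of_diagonal
      (m := fun i => Real.exp (-(lam i * (h + s))) - Real.exp (-(lam i * s))) (fun i => ?_)
      (by positivity) fun i => exp_sub_exp_le_rpow (he.pos hA i) h0 h1 hh hs
    rw [_root_.sub_apply, hS.apply_eigenvector he i hs.le,
      hS.apply_eigenvector he i (by positivity : 0 ≤ h + s), sub_smul]
  compact t ht := hS.isCompactOperator hA he ht

end Semigroup

/-! ### Consequences of the smoothing estimate -/

section SmoothingSemigroup

variable {V : Type*} [NormedAddCommGroup V] [NormedSpace ℝ V] {S : ℝ → V →L[ℝ] V}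

theorem IsSmoothingSemigroup.norm_sub_le (hS : IsSmoothingSemigroup S) {δ s t : ℝ} (h0 : 0 ≤ δ)
    (h1 : δ ≤ 1) (hs : 0 < s) (hst : s ≤ t) : ‖S t - S s‖ ≤ (t - s) ^ δ * s ^ (-δ) := by
  simpa using hS.smoothing δ (t - s) s h0 h1 (sub_nonneg.2 hst) hs

theorem IsSmoothingSemigroup.norm_apply_le (hS : IsSmoothingSemigroup S) {t : ℝ} (ht : 0 ≤ t)
    (v : V) : ‖S t v‖ ≤ ‖v‖ := by
  simpa using (S t).le_of_opNorm_le (hS.norm_le_one t ht) v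

theorem IsSmoothingSemigroup.sub_id_comp (hS : IsSmoothingSemigroup S) {h s : ℝ} (hh : 0 ≤ h)
    (hs : 0 ≤ s) : (S h - ContinuousLinearMap.id ℝ V).comp (S s) = S (h + s) - S s := by
  rw [ContinuousLinearMap.sub_comp, hS.add h s hh hs, ContinuousLinearMap.id_comp]

/-- The smoothing estimate with exponent one gives the Lipschitz constant `1/a` on `(a, ∞)`. Norm
continuity supplies the measurability of operator valued integrands. -/
theorem IsSmoothingSemigroup.continuousOn_Ioi (hS : IsSmoothingSemigroup S) :
    ContinuousOn S (Ioi 0) := by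
  have key : ∀ a : ℝ, 0 < a → ContinuousOn S (Ioi a) := by
    intro a ha
    refine (LipschitzOnWith.of_dist_le_mul (K := (a⁻¹).toNNReal) ?_).continuousOn
    have key2 : ∀ x y : ℝ, a < x → x ≤ y → ‖S y - S x‖ ≤ a⁻¹ * |y - x| := by
      intro x y hx hxy
      refine (hS.norm_sub_le zero_le_one le_rfl (ha.trans hx) hxy).trans ?_
      rw [Real.rpow_one, Real.rpow_neg_one, mul_comm, abs_of_nonneg (sub_nonneg.2 hxy)]
      have := sub_nonneg.2 hxy
      gcongr
    intro x hx y hy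
    rw [Real.coe_toNNReal _ (by positivity), dist_eq_norm, Real.dist_eq]
    rcases le_total x y with h | h
    · rw [norm_sub_rev, abs_sub_comm]
      exact key2 x y hx h
    · exact key2 y x hy h
  intro x hx
  have hx : 0 < x := hx
  exact ((key (x / 2) (by positivity)).continuousAt (Ioi_mem_nhds (by linarith))).continuousWithinAt

end SmoothingSemigroup

/-! ### Integrals of powers -/

section Integrals

variable {E : Type*} [NormedAddCommGroup E]

/-- Bounds are required only on the open interval: the singular weights take the default value `0`
at the endpoints, where they bound nothing. -/
theorem intervalIntegrable_of_norm_le_Ioo {f : ℝ → E} {g : ℝ → ℝ} {a b : ℝ} (hab : a ≤ b)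
    (hf : AEStronglyMeasurable f (volume.restrict (Ioo a b)))
    (hg : IntervalIntegrable g volume a b) (h : ∀ x ∈ Ioo a b, ‖f x‖ ≤ g x) :
    IntervalIntegrable f volume a b := by
  rw [intervalIntegrable_iff_integrableOn_Ioo_of_le hab] at hg ⊢
  exact Integrable.mono' hg hf ((ae_restrict_iff' measurableSet_Ioo).2 (ae_of_all _ h))

theorem ae_mem_Ioc_of_Ioo {p : ℝ → Prop} {a b : ℝ} (h : ∀ x ∈ Ioo a b, p x) :
    ∀ᵐ x : ℝ, x ∈ Ioc a b → p x := by
  have : ∀ᵐ x : ℝ, x ≠ b := by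
    simp [ae_iff]
  filter_upwards [this] with x hx hx'
  exact h x ⟨hx'.1, lt_of_le_of_ne hx'.2 hx⟩

variable [NormedSpace ℝ E]

theorem norm_intervalIntegral_le_of_Ioo {f : ℝ → E} {g : ℝ → ℝ} {a b : ℝ} (hab : a ≤ b)
    (h : ∀ x ∈ Ioo a b, ‖f x‖ ≤ g x) (hg : IntervalIntegrable g volume a b) :
    ‖∫ x in a..b, f x‖ ≤ ∫ x in a..b, g x :=
  intervalIntegral.norm_integral_le_of_norm_le hab (ae_mem_Ioc_of_Ioo h) hg

theorem intervalIntegral_congr_Ioo {f g : ℝ → E} {a b : ℝ} (hab : a ≤ b)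
    (h : ∀ x ∈ Ioo a b, f x = g x) : ∫ x in a..b, f x = ∫ x in a..b, g x := by
  refine intervalIntegral.integral_congr_ae ?_
  rw [uIoc_of_le hab]
  exact ae_mem_Ioc_of_Ioo h

theorem intervalIntegrable_sub_rpow {p : ℝ} (hp : -1 < p) (a b c : ℝ) :
    IntervalIntegrable (fun r : ℝ => (r - c) ^ p) volume a b := by
  have := (intervalIntegral.intervalIntegrable_rpow' (a := a - c) (b := b - c) hp).comp_sub_right c
  simpa using this

theorem intervalIntegrable_rsub_rpow {p : ℝ} (hp : -1 < p) (a b c : ℝ) :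
    IntervalIntegrable (fun r : ℝ => (c - r) ^ p) volume a b := by
  have := (intervalIntegral.intervalIntegrable_rpow' (a := c - a) (b := c - b) hp).comp_sub_left c
  simpa using this

theorem integral_sub_rpow {p : ℝ} (hp : -1 < p) (s t : ℝ) :
    ∫ r in s..t, (r - s) ^ p = (t - s) ^ (p + 1) / (p + 1) := by
  rw [intervalIntegral.integral_comp_sub_right (fun x => x ^ p), integral_rpow (Or.inl hp),
    sub_self, Real.zero_rpow (by linarith), sub_zero]

theorem integral_rsub_rpow {p : ℝ} (hp : -1 < p) (s t : ℝ) :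
    ∫ r in s..t, (t - r) ^ p = (t - s) ^ (p + 1) / (p + 1) := by
  rw [intervalIntegral.integral_comp_sub_left (fun x => x ^ p), integral_rpow (Or.inl hp),
    sub_self, Real.zero_rpow (by linarith), sub_zero]

/-- For `q ≥ 0` the summand `1` suffices, for `q ≤ 0` the summand `2 ^ (-q)`; their sum avoids
distinguishing signs later. -/
theorem rpow_le_of_half_le {x h q : ℝ} (hh : 0 < h) (h1 : h / 2 ≤ x) (h2 : x ≤ h) :
    x ^ q ≤ (1 + 2 ^ (-q)) * h ^ q := by
  have hq : 0 ≤ h ^ q := by positivity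
  have h2q : (0 : ℝ) ≤ 2 ^ (-q) := by positivity
  rcases le_total 0 q with h0 | h0
  · have := Real.rpow_le_rpow (by linarith) h2 h0
    nlinarith
  · have := Real.rpow_le_rpow_of_nonpos (by linarith) h1 h0
    rw [Real.div_rpow hh.le zero_le_two, div_eq_mul_inv, ← Real.rpow_neg zero_le_two] at this
    nlinarith

/-- A constant that bounds Euler's Beta integral `∫ r in 0..1, r ^ p * (1 - r) ^ q`. -/
def betaConst (p q : ℝ) : ℝ := (1 + 2 ^ (-q)) / (p + 1) + (1 + 2 ^ (-p)) / (q + 1)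

theorem betaConst_nonneg {p q : ℝ} (hp : -1 < p) (hq : -1 < q) : 0 ≤ betaConst p q := by
  have h1 : 0 < p + 1 := by linarith
  have h2 : 0 < q + 1 := by linarith
  unfold betaConst
  positivity

/-- On each half of the interval the distance to the farther endpoint is comparable with `t - s`, so
a Beta integrand reduces to single powers. -/
theorem rpow_mul_rpow_le {p q r s t : ℝ} (hsr : s < r) (hrt : r < t) :
    (r - s) ^ p * (t - r) ^ q ≤ (1 + 2 ^ (-q)) * (t - s) ^ q * (r - s) ^ p +
      (1 + 2 ^ (-p)) * (t - s) ^ p * (t - r) ^ q := by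
  have h0 : 0 ≤ (r - s) ^ p := Real.rpow_nonneg (by linarith) _
  have h1 : 0 ≤ (t - r) ^ q := Real.rpow_nonneg (by linarith) _
  have h2 : 0 ≤ (1 + 2 ^ (-q)) * (t - s) ^ q :=
    mul_nonneg (by positivity) (Real.rpow_nonneg (by linarith) _)
  have h3 : 0 ≤ (1 + 2 ^ (-p)) * (t - s) ^ p :=
    mul_nonneg (by positivity) (Real.rpow_nonneg (by linarith) _)
  rcases le_total (r - s) (t - r) with h | h
  · have := rpow_le_of_half_le (x := t - r) (h := t - s) (q := q) (by linarith) (by linarith)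
      (by linarith)
    nlinarith [mul_nonneg h3 h1]
  · have := rpow_le_of_half_le (x := r - s) (h := t - s) (q := p) (by linarith) (by linarith)
      (by linarith)
    nlinarith [mul_nonneg h2 h0]

theorem aestronglyMeasurable_rpow_mul_rpow (p q s t : ℝ) {μ : Measure ℝ} :
    AEStronglyMeasurable (fun r : ℝ => (r - s) ^ p * (t - r) ^ q) μ := by
  have : Measurable fun r : ℝ => (r - s) ^ p * (t - r) ^ q := by fun_prop
  exact this.aestronglyMeasurable

theorem intervalIntegrable_rpow_mul_rpow {p q s t : ℝ} (hp : -1 < p) (hq : -1 < q) (hst : s ≤ t) :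
    IntervalIntegrable (fun r : ℝ => (r - s) ^ p * (t - r) ^ q) volume s t := by
  refine intervalIntegrable_of_norm_le_Ioo hst (aestronglyMeasurable_rpow_mul_rpow p q s t)
    (((intervalIntegrable_sub_rpow hp s t s).const_mul ((1 + 2 ^ (-q)) * (t - s) ^ q)).add
      ((intervalIntegrable_rsub_rpow hq s t t).const_mul ((1 + 2 ^ (-p)) * (t - s) ^ p)))
    fun r hr => ?_
  rw [Real.norm_of_nonneg (mul_nonneg (Real.rpow_nonneg (by linarith [hr.1]) _)
    (Real.rpow_nonneg (by linarith [hr.2]) _))]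
  exact rpow_mul_rpow_le hr.1 hr.2

theorem integral_rpow_mul_rpow_le {p q s t : ℝ} (hp : -1 < p) (hq : -1 < q) (hst : s < t) :
    ∫ r in s..t, (r - s) ^ p * (t - r) ^ q ≤ betaConst p q * (t - s) ^ (p + q + 1) := by
  have i1 := (intervalIntegrable_sub_rpow hp s t s).const_mul ((1 + 2 ^ (-q)) * (t - s) ^ q)
  have i2 := (intervalIntegrable_rsub_rpow hq s t t).const_mul ((1 + 2 ^ (-p)) * (t - s) ^ p)
  have h : 0 < t - s := sub_pos.2 hst
  calc ∫ r in s..t, (r - s) ^ p * (t - r) ^ q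
      ≤ ∫ r in s..t, ((1 + 2 ^ (-q)) * (t - s) ^ q * (r - s) ^ p +
          (1 + 2 ^ (-p)) * (t - s) ^ p * (t - r) ^ q) := by
        refine (Real.le_norm_self _).trans (norm_intervalIntegral_le_of_Ioo hst.le (fun r hr => ?_)
          (i1.add i2))
        rw [Real.norm_of_nonneg (mul_nonneg (Real.rpow_nonneg (by linarith [hr.1]) _)
          (Real.rpow_nonneg (by linarith [hr.2]) _))]
        exact rpow_mul_rpow_le hr.1 hr.2
    _ = betaConst p q * (t - s) ^ (p + q + 1) := by
        rw [intervalIntegral.integral_add i1 i2, intervalIntegral.integral_const_mul,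
          intervalIntegral.integral_const_mul, integral_sub_rpow hp, integral_rsub_rpow hq,
          betaConst, show p + q + 1 = q + (p + 1) by ring, Real.rpow_add h q (p + 1),
          Real.rpow_add h p 1, Real.rpow_add h q 1]
        ring

end Integrals

/-! ### Fractional derivatives of vector valued functions -/

section FractionalDerivatives

variable {E : Type*} [NormedAddCommGroup E] [NormedSpace ℝ E]
  {E' : Type*} [NormedAddCommGroup E'] [NormedSpace ℝ E']

/-- Vector valued version of `leftFracKernel`. -/
def leftFracKernelVec (α : ℝ) (f : ℝ → E) (r q : ℝ) : E :=
  ((r - q) ^ (1 + α))⁻¹ • (f r - f q)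

/-- Vector valued version of `leftFracDeriv`. -/
def leftFracDerivVec (α s : ℝ) (f : ℝ → E) (r : ℝ) : E :=
  (1 / Real.Gamma (1 - α)) •
    (((r - s) ^ α)⁻¹ • f r + α • ∫ q in s..r, leftFracKernelVec α f r q)

/-- Vector valued version of `rightFracKernel`. -/
def rightFracKernelVec (α : ℝ) (w : ℝ → E) (r q : ℝ) : E :=
  ((q - r) ^ (2 - α))⁻¹ • (w r - w q)

/-- Vector valued version of `rightFracDeriv`. -/
def rightFracDerivVec (α t : ℝ) (w : ℝ → E) (r : ℝ) : E :=
  (1 / Real.Gamma α) •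
    (((t - r) ^ (1 - α))⁻¹ • (w r - w t) + (1 - α) • ∫ q in r..t, rightFracKernelVec α w r q)

theorem leftFracKernelVec_real (α : ℝ) (f : ℝ → ℝ) :
    leftFracKernelVec α f = leftFracKernel α f := by
  ext r q
  rw [leftFracKernelVec, leftFracKernel, smul_eq_mul, div_eq_inv_mul]

theorem leftFracDerivVec_real (α s : ℝ) (f : ℝ → ℝ) :
    leftFracDerivVec α s f = leftFracDeriv α s f := by
  ext r
  simp only [leftFracDerivVec, leftFracDeriv, leftFracKernelVec_real, smul_eq_mul, div_eq_inv_mul]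

theorem rightFracKernelVec_real (α : ℝ) (w : ℝ → ℝ) :
    rightFracKernelVec α w = rightFracKernel α w := by
  ext r q
  rw [rightFracKernelVec, rightFracKernel, smul_eq_mul, div_eq_inv_mul]

theorem rightFracDerivVec_real (α t : ℝ) (w : ℝ → ℝ) :
    rightFracDerivVec α t w = rightFracDeriv α t w := by
  ext r
  simp only [rightFracDerivVec, rightFracDeriv, rightFracKernelVec_real, smul_eq_mul,
    div_eq_inv_mul]

theorem leftFracKernelVec_clm (α : ℝ) (L : E →L[ℝ] E') (f : ℝ → E) (r q : ℝ) :
    leftFracKernelVec α (fun x => L (f x)) r q = L (leftFracKernelVec α f r q) := by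
  simp [leftFracKernelVec]

theorem rightFracKernelVec_clm (α : ℝ) (L : E →L[ℝ] E') (w : ℝ → E) (r q : ℝ) :
    rightFracKernelVec α (fun x => L (w x)) r q = L (rightFracKernelVec α w r q) := by
  simp [rightFracKernelVec]

section Complete

variable [CompleteSpace E] [CompleteSpace E']

/-- Used to pass to matrix entries and to move `P` or `S (t - s)` through the derivative.
Integrability of the kernel justifies commuting with the integral. -/
theorem leftFracDerivVec_clm {α s r : ℝ} (L : E →L[ℝ] E') {f : ℝ → E}
    (hf : IntervalIntegrable (leftFracKernelVec α f r) volume s r) :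
    leftFracDerivVec α s (fun x => L (f x)) r = L (leftFracDerivVec α s f r) := by
  simp only [leftFracDerivVec, leftFracKernelVec_clm, map_smul, map_add]
  rw [ContinuousLinearMap.intervalIntegral_comp_comm L hf]

theorem rightFracDerivVec_clm {α t r : ℝ} (L : E →L[ℝ] E') {w : ℝ → E}
    (hw : IntervalIntegrable (rightFracKernelVec α w r) volume r t) :
    rightFracDerivVec α t (fun x => L (w x)) r = L (rightFracDerivVec α t w r) := by
  simp only [rightFracDerivVec, rightFracKernelVec_clm, map_smul, map_add, map_sub]
  rw [ContinuousLinearMap.intervalIntegral_comp_comm L hw]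

end Complete

/-! #### Measurability -/

/-- Writing the inner integral as an integral over all of `ℝ` of a jointly measurable indicator
turns the moving endpoint into a parameter. -/
theorem aestronglyMeasurable_leftFracDerivVec {α s : ℝ} {f : ℝ → E} (hf : StronglyMeasurable f) :
    AEStronglyMeasurable (leftFracDerivVec α s f) (volume.restrict (Ioi s)) := by
  have h1 : StronglyMeasurable fun p : ℝ × ℝ =>
      indicator {p : ℝ × ℝ | s < p.2 ∧ p.2 ≤ p.1}
        (fun p => leftFracKernelVec α f p.1 p.2) p := by
    refine StronglyMeasurable.indicator ?_ ?_
    · have m1 : Measurable fun p : ℝ × ℝ => ((p.1 - p.2) ^ (1 + α))⁻¹ := by fun_prop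
      exact m1.stronglyMeasurable.smul ((hf.comp_measurable measurable_fst).sub
        (hf.comp_measurable measurable_snd))
    · exact (measurableSet_lt measurable_const measurable_snd).inter
        (measurableSet_le measurable_snd measurable_fst)
  have h2 := h1.integral_prod_right' (ν := (volume : Measure ℝ))
  have m2 : Measurable fun r : ℝ => ((r - s) ^ α)⁻¹ := by fun_prop
  have h3 := ((m2.stronglyMeasurable.smul hf).add (h2.const_smul α)).const_smul
    (1 / Real.Gamma (1 - α))
  refine AEStronglyMeasurable.congr h3.aestronglyMeasurable ?_
  refine (ae_restrict_iff' measurableSet_Ioi).2 (ae_of_all _ fun r hr => ?_)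
  have hr : s < r := hr
  simp only [leftFracDerivVec, Pi.smul_apply, Pi.add_apply]
  rw [intervalIntegral.integral_of_le hr.le, ← integral_indicator measurableSet_Ioc]
  rfl

theorem aestronglyMeasurable_rightFracDerivVec {α t : ℝ} {w : ℝ → E} (hw : StronglyMeasurable w) :
    AEStronglyMeasurable (rightFracDerivVec α t w) (volume.restrict (Iio t)) := by
  have h1 : StronglyMeasurable fun p : ℝ × ℝ =>
      indicator {p : ℝ × ℝ | p.1 < p.2 ∧ p.2 ≤ t}
        (fun p => rightFracKernelVec α w p.1 p.2) p := by
    refine StronglyMeasurable.indicator ?_ ?_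
    · have m1 : Measurable fun p : ℝ × ℝ => ((p.2 - p.1) ^ (2 - α))⁻¹ := by fun_prop
      exact m1.stronglyMeasurable.smul ((hw.comp_measurable measurable_fst).sub
        (hw.comp_measurable measurable_snd))
    · exact (measurableSet_lt measurable_fst measurable_snd).inter
        (measurableSet_le measurable_snd measurable_const)
  have h2 := h1.integral_prod_right' (ν := (volume : Measure ℝ))
  have m2 : Measurable fun r : ℝ => ((t - r) ^ (1 - α))⁻¹ := by fun_prop
  have h3 := ((m2.stronglyMeasurable.smul (hw.sub (stronglyMeasurable_const (b := w t)))).add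
    (h2.const_smul (1 - α))).const_smul (1 / Real.Gamma α)
  refine AEStronglyMeasurable.congr h3.aestronglyMeasurable ?_
  refine (ae_restrict_iff' measurableSet_Iio).2 (ae_of_all _ fun r hr => ?_)
  have hr : r < t := hr
  simp only [rightFracDerivVec, Pi.smul_apply, Pi.add_apply]
  rw [intervalIntegral.integral_of_le hr.le, ← integral_indicator measurableSet_Ioc]
  rfl

/-! #### Estimates of the right sided derivative -/

section Right

variable {α θ R t r : ℝ} {w : ℝ → E}

theorem norm_rightFracKernelVec_le (hw : ∀ q, r ≤ q → q ≤ t → ‖w r - w q‖ ≤ R * (q - r) ^ θ)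
    {q : ℝ} (hq : q ∈ Ioo r t) : ‖rightFracKernelVec α w r q‖ ≤ R * (q - r) ^ (θ + α - 2) := by
  have h : 0 < q - r := sub_pos.2 hq.1
  rw [rightFracKernelVec, norm_smul, norm_inv, Real.norm_of_nonneg (by positivity)]
  calc ((q - r) ^ (2 - α))⁻¹ * ‖w r - w q‖ ≤ ((q - r) ^ (2 - α))⁻¹ * (R * (q - r) ^ θ) := by
        gcongr
        exact hw q hq.1.le hq.2.le
    _ = R * (q - r) ^ (θ + α - 2) := by
        rw [← Real.rpow_neg h.le, show θ + α - 2 = -(2 - α) + θ by ring, Real.rpow_add h]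
        ring

theorem intervalIntegrable_rightFracKernelVec (hw : StronglyMeasurable w)
    (hwH : ∀ q, r ≤ q → q ≤ t → ‖w r - w q‖ ≤ R * (q - r) ^ θ) (hα : 1 < θ + α) (hrt : r ≤ t) :
    IntervalIntegrable (rightFracKernelVec α w r) volume r t := by
  refine intervalIntegrable_of_norm_le_Ioo hrt ?_
    ((intervalIntegrable_sub_rpow (by linarith : -1 < θ + α - 2) r t r).const_mul R)
    fun q hq => norm_rightFracKernelVec_le hwH hq
  have m1 : Measurable fun q : ℝ => ((q - r) ^ (2 - α))⁻¹ := by fun_prop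
  exact (m1.stronglyMeasurable.smul (stronglyMeasurable_const.sub hw)).aestronglyMeasurable

/-- The constant in the estimate of `rightFracDerivVec` of a Hölder continuous function. -/
def rightFracConst (α θ R : ℝ) : ℝ := 1 / Real.Gamma α * (R + (1 - α) * (R / (θ + α - 1)))

theorem rightFracConst_nonneg (hα0 : 0 < α) (hα1 : α < 1) (hα : 1 < θ + α) (hR : 0 ≤ R) :
    0 ≤ rightFracConst α θ R := by
  have h1 : 0 < 1 - α := by linarith
  have h2 : 0 < θ + α - 1 := by linarith
  have h3 := Real.Gamma_pos_of_pos hα0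
  unfold rightFracConst
  positivity

theorem norm_rightFracDerivVec_le
    (hwH : ∀ q, r ≤ q → q ≤ t → ‖w r - w q‖ ≤ R * (q - r) ^ θ) (hα0 : 0 < α) (hα1 : α < 1)
    (hα : 1 < θ + α) (hrt : r < t) :
    ‖rightFracDerivVec α t w r‖ ≤ rightFracConst α θ R * (t - r) ^ (θ + α - 1) := by
  have h : 0 < t - r := sub_pos.2 hrt
  have hG := Real.Gamma_pos_of_pos hα0
  have h1 : ‖((t - r) ^ (1 - α))⁻¹ • (w r - w t)‖ ≤ R * (t - r) ^ (θ + α - 1) := by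
    rw [norm_smul, norm_inv, Real.norm_of_nonneg (by positivity)]
    calc ((t - r) ^ (1 - α))⁻¹ * ‖w r - w t‖ ≤ ((t - r) ^ (1 - α))⁻¹ * (R * (t - r) ^ θ) := by
          gcongr
          exact hwH t hrt.le le_rfl
      _ = R * (t - r) ^ (θ + α - 1) := by
          rw [← Real.rpow_neg h.le, show θ + α - 1 = -(1 - α) + θ by ring, Real.rpow_add h]
          ring
  have h2 : ‖∫ q in r..t, rightFracKernelVec α w r q‖ ≤
      R / (θ + α - 1) * (t - r) ^ (θ + α - 1) := by
    have hp : -1 < θ + α - 2 := by linarith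
    refine (norm_intervalIntegral_le_of_Ioo hrt.le
      (fun q hq => norm_rightFracKernelVec_le hwH hq)
      ((intervalIntegrable_sub_rpow hp r t r).const_mul R)).trans_eq ?_
    rw [intervalIntegral.integral_const_mul, integral_sub_rpow hp,
      show θ + α - 2 + 1 = θ + α - 1 by ring]
    ring
  rw [rightFracDerivVec, norm_smul, Real.norm_of_nonneg (by positivity), rightFracConst, mul_assoc]
  refine mul_le_mul_of_nonneg_left ?_ (by positivity)
  refine (norm_add_le _ _).trans ?_
  have h1α : 0 ≤ 1 - α := by linarith
  rw [norm_smul (1 - α), Real.norm_of_nonneg h1α, add_mul, mul_assoc]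
  gcongr

/-- Split the kernel integral at `s` and write `w r - w q = (w r - w s) + (w s - w q)` beyond `s`.
The coefficient of `w r - w s` integrates explicitly and cancels against the boundary terms, so only
increments of `w` on `[s, t]` survive. This yields the factor `(t - s) ^ θ`, at the price of `(s -
r) ^ (α - 1)`. The constant `R'` serves integrability only. -/
theorem norm_rightFracDerivVec_sub_le [CompleteSpace E] {s : ℝ} (hw : StronglyMeasurable w) {R' : ℝ}
    (hwr : ∀ q, r ≤ q → q ≤ t → ‖w r - w q‖ ≤ R' * (q - r) ^ θ)
    (hws : ∀ q, s ≤ q → q ≤ t → ‖w s - w q‖ ≤ R * (q - s) ^ θ) (hR : 0 ≤ R) (hθ : 0 ≤ θ)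
    (hα0 : 0 < α) (hα1 : α < 1) (hα : 1 < θ + α) (hrs : r < s) (hst : s ≤ t) :
    ‖rightFracDerivVec α t w r - rightFracDerivVec α s w r‖ ≤
      1 / Real.Gamma α * (R * (t - s) ^ θ * (s - r) ^ (α - 1)) := by
  have hG := Real.Gamma_pos_of_pos hα0
  have hs : 0 < s - r := sub_pos.2 hrs
  have hts : 0 ≤ t - s := sub_nonneg.2 hst
  have ht : 0 < t - r := by linarith
  have it := intervalIntegrable_rightFracKernelVec hw hwr hα (hrs.le.trans hst)
  have is1 := it.mono_set (uIcc_subset_uIcc left_mem_uIcc (mem_uIcc_of_le hrs.le hst))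
  have is2 := it.mono_set (uIcc_subset_uIcc (mem_uIcc_of_le hrs.le hst) right_mem_uIcc)
  have hne : ∀ q ∈ uIcc s t, (q - r) ≠ 0 := by
    intro q hq
    rw [uIcc_of_le hst] at hq
    have := hq.1
    exact (by linarith : 0 < q - r).ne'
  have ik : IntervalIntegrable (fun q : ℝ => (q - r) ^ (α - 2)) volume s t := by
    refine ContinuousOn.intervalIntegrable ?_
    exact (continuousOn_id.sub continuousOn_const).rpow_const fun q hq => Or.inl (hne q hq)
  -- The two boundary powers are the coefficients of the boundary terms for the terminal times `s`
  -- and `t`; this identity drives the cancellation.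
  have ival : (1 - α) * ∫ q in s..t, (q - r) ^ (α - 2) =
      (s - r) ^ (α - 1) - (t - r) ^ (α - 1) := by
    rw [intervalIntegral.integral_comp_sub_right (fun x => x ^ (α - 2)),
      integral_rpow (Or.inr ⟨by linarith, ?_⟩), show α - 2 + 1 = α - 1 by ring]
    · have : α - 1 ≠ 0 := by linarith
      field_simp
      ring
    · rw [uIcc_of_le (by linarith)]
      intro h
      linarith [h.1]
  have e1 : ∀ q ∈ Icc s t, rightFracKernelVec α w r q =
      (q - r) ^ (α - 2) • (w r - w s) + (q - r) ^ (α - 2) • (w s - w q) := by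
    intro q hq
    have : 0 ≤ q - r := by linarith [hq.1]
    rw [rightFracKernelVec, ← Real.rpow_neg this, ← smul_add, sub_add_sub_cancel, neg_sub]
  have i1 : IntervalIntegrable (fun q : ℝ => (q - r) ^ (α - 2) • (w r - w s)) volume s t := by
    exact ⟨ik.1.smul_const _, ik.2.smul_const _⟩
  have i2 : IntervalIntegrable (fun q : ℝ => (q - r) ^ (α - 2) • (w s - w q)) volume s t := by
    refine (is2.sub i1).congr ?_
    rw [uIoc_of_le hst]
    intro q hq
    simp only
    rw [e1 q ⟨hq.1.le, hq.2⟩]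
    abel
  have b2 : ‖∫ q in s..t, (q - r) ^ (α - 2) • (w s - w q)‖ ≤
      R * (t - s) ^ θ * ∫ q in s..t, (q - r) ^ (α - 2) := by
    rw [← intervalIntegral.integral_const_mul]
    refine norm_intervalIntegral_le_of_Ioo hst (fun q hq => ?_) (ik.const_mul _)
    have h0 : 0 ≤ q - s := by linarith [hq.1]
    have h1 : 0 < q - r := by linarith [hq.1]
    rw [norm_smul, Real.norm_of_nonneg (by positivity), mul_comm]
    gcongr
    refine (hws q hq.1.le hq.2.le).trans ?_
    gcongr
    exact hq.2.le
  have e2 : rightFracDerivVec α t w r - rightFracDerivVec α s w r =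
      (1 / Real.Gamma α) • ((t - r) ^ (α - 1) • (w s - w t) +
        (1 - α) • ∫ q in s..t, (q - r) ^ (α - 2) • (w s - w q)) := by
    have e3 : ∫ q in r..t, rightFracKernelVec α w r q =
        (∫ q in r..s, rightFracKernelVec α w r q) + ((∫ q in s..t, (q - r) ^ (α - 2)) •
          (w r - w s) + ∫ q in s..t, (q - r) ^ (α - 2) • (w s - w q)) := by
      rw [← intervalIntegral.integral_add_adjacent_intervals is1 is2,
        ← intervalIntegral.integral_smul_const, ← intervalIntegral.integral_add i1 i2]
      congr 1
      refine intervalIntegral.integral_congr fun q hq => ?_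
      rw [uIcc_of_le hst] at hq
      exact e1 q hq
    rw [rightFracDerivVec, rightFracDerivVec, e3, ← smul_sub]
    congr 1
    rw [smul_add, smul_add, smul_smul, ival, ← Real.rpow_neg ht.le, ← Real.rpow_neg hs.le, neg_sub]
    module
  rw [e2, norm_smul, Real.norm_of_nonneg (by positivity)]
  refine mul_le_mul_of_nonneg_left ?_ (by positivity)
  refine (norm_add_le _ _).trans ?_
  rw [norm_smul, norm_smul, Real.norm_of_nonneg (by positivity : 0 ≤ (t - r) ^ (α - 1)),
    Real.norm_of_nonneg (by linarith : 0 ≤ 1 - α)]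
  calc (t - r) ^ (α - 1) * ‖w s - w t‖ + (1 - α) * ‖∫ q in s..t, (q - r) ^ (α - 2) • (w s - w q)‖
      ≤ (t - r) ^ (α - 1) * (R * (t - s) ^ θ) +
        (1 - α) * (R * (t - s) ^ θ * ∫ q in s..t, (q - r) ^ (α - 2)) := by
        have := hws t hst le_rfl
        have : 0 ≤ 1 - α := by linarith
        gcongr
    _ = R * (t - s) ^ θ * ((t - r) ^ (α - 1) + (1 - α) * ∫ q in s..t, (q - r) ^ (α - 2)) := by
        ring
    _ = R * (t - s) ^ θ * (s - r) ^ (α - 1) := by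
        rw [ival]
        ring

end Right

/-! #### Estimates of the left sided derivative -/

section Left

variable {α β γ a₀ a₁ a₂ r : ℝ} {f : ℝ → E}

/-- The modulus has two parts: `q ^ (-β) * (r - q) ^ β` comes from a path in `C^β_β`, and `(r - q) ^
γ` from increments of the semigroup. -/
theorem norm_leftFracKernelVec_le
    (hf : ∀ q ∈ Ioo 0 r, ‖f r - f q‖ ≤ a₁ * (q ^ (-β) * (r - q) ^ β) + a₂ * (r - q) ^ γ)
    {q : ℝ} (hq : q ∈ Ioo 0 r) :
    ‖leftFracKernelVec α f r q‖ ≤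
      a₁ * ((q - 0) ^ (-β) * (r - q) ^ (β - 1 - α)) + a₂ * (r - q) ^ (γ - 1 - α) := by
  have h : 0 < r - q := sub_pos.2 hq.2
  rw [leftFracKernelVec, norm_smul, norm_inv, Real.norm_of_nonneg (by positivity), sub_zero]
  calc ((r - q) ^ (1 + α))⁻¹ * ‖f r - f q‖
      ≤ ((r - q) ^ (1 + α))⁻¹ * (a₁ * (q ^ (-β) * (r - q) ^ β) + a₂ * (r - q) ^ γ) := by
        gcongr
        exact hf q hq
    _ = _ := by
        rw [← Real.rpow_neg h.le, show β - 1 - α = -(1 + α) + β by ring,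
          show γ - 1 - α = -(1 + α) + γ by ring, Real.rpow_add h, Real.rpow_add h]
        ring

theorem intervalIntegrable_leftFracKernelBound (hβ : β < 1) (hαβ : α < β) (hαγ : α < γ)
    (hr : 0 ≤ r) : IntervalIntegrable (fun q : ℝ =>
      a₁ * ((q - 0) ^ (-β) * (r - q) ^ (β - 1 - α)) + a₂ * (r - q) ^ (γ - 1 - α)) volume 0 r :=
  ((intervalIntegrable_rpow_mul_rpow (by linarith) (by linarith) hr).const_mul a₁).add
    ((intervalIntegrable_rsub_rpow (by linarith) 0 r r).const_mul a₂)

theorem intervalIntegrable_leftFracKernelVec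
    (hfm : AEStronglyMeasurable f (volume.restrict (Ioo 0 r)))
    (hf : ∀ q ∈ Ioo 0 r, ‖f r - f q‖ ≤ a₁ * (q ^ (-β) * (r - q) ^ β) + a₂ * (r - q) ^ γ)
    (hβ : β < 1) (hαβ : α < β) (hαγ : α < γ) (hr : 0 ≤ r) :
    IntervalIntegrable (leftFracKernelVec α f r) volume 0 r := by
  refine intervalIntegrable_of_norm_le_Ioo hr ?_
    (intervalIntegrable_leftFracKernelBound hβ hαβ hαγ hr)
    fun q hq => norm_leftFracKernelVec_le hf hq
  have m1 : Measurable fun q : ℝ => ((r - q) ^ (1 + α))⁻¹ := by fun_prop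
  exact m1.aestronglyMeasurable.smul (aestronglyMeasurable_const.sub hfm)

/-- The exponents `-β` and `β - 1 - α` of the Beta integral combine to `r ^ (-α)`, the same
singularity as in the boundary term: the weight at time zero costs nothing extra. -/
theorem norm_leftFracDerivVec_le (hf0 : ‖f r‖ ≤ a₀)
    (hf : ∀ q ∈ Ioo 0 r, ‖f r - f q‖ ≤ a₁ * (q ^ (-β) * (r - q) ^ β) + a₂ * (r - q) ^ γ)
    (ha₁ : 0 ≤ a₁) (hβ : β < 1) (hα0 : 0 < α) (hαβ : α < β) (hαγ : α < γ) (hr : 0 < r) :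
    ‖leftFracDerivVec α 0 f r‖ ≤ 1 / Real.Gamma (1 - α) * (a₀ * r ^ (-α) +
      α * (a₁ * (betaConst (-β) (β - 1 - α) * r ^ (-α)) + a₂ * (r ^ (γ - α) / (γ - α)))) := by
  have hG := Real.Gamma_pos_of_pos (by linarith : 0 < 1 - α)
  have hp : -1 < -β := by linarith
  have hq : -1 < β - 1 - α := by linarith
  have hq' : -1 < γ - 1 - α := by linarith
  have h2 : ‖∫ q in (0 : ℝ)..r, leftFracKernelVec α f r q‖ ≤
      a₁ * (betaConst (-β) (β - 1 - α) * r ^ (-α)) + a₂ * (r ^ (γ - α) / (γ - α)) := by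
    refine (norm_intervalIntegral_le_of_Ioo hr.le
      (fun q hq => norm_leftFracKernelVec_le hf hq)
      (intervalIntegrable_leftFracKernelBound hβ hαβ hαγ hr.le)).trans ?_
    rw [intervalIntegral.integral_add
      ((intervalIntegrable_rpow_mul_rpow hp hq hr.le).const_mul a₁)
      ((intervalIntegrable_rsub_rpow hq' 0 r r).const_mul a₂),
      intervalIntegral.integral_const_mul, intervalIntegral.integral_const_mul,
      integral_rsub_rpow hq', sub_zero, show γ - 1 - α + 1 = γ - α by ring]
    gcongr
    refine (integral_rpow_mul_rpow_le hp hq hr).trans_eq ?_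
    rw [sub_zero, show -β + (β - 1 - α) + 1 = -α by ring]
  rw [leftFracDerivVec, norm_smul, Real.norm_of_nonneg (by positivity)]
  refine mul_le_mul_of_nonneg_left ?_ (by positivity)
  refine (norm_add_le _ _).trans ?_
  rw [norm_smul, norm_smul, norm_inv, Real.norm_of_nonneg hα0.le, sub_zero,
    Real.norm_of_nonneg (by positivity), ← Real.rpow_neg hr.le, mul_comm (r ^ (-α))]
  gcongr

end Left

end FractionalDerivatives

/-! ### The pathwise integral as a Bochner integral -/

section PathwiseIntegralEq

variable {V : Type*} [NormedAddCommGroup V] [InnerProductSpace ℝ V] {ι : Type*}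

/-- The matrix entry `(e j, B (e i))` as a continuous linear functional of the operator `B`. -/
def matrixEntry (e : HilbertBasis ι ℝ V) (j i : ι) : (V →L[ℝ] V) →L[ℝ] ℝ :=
  (innerSL ℝ (e j)).comp (ContinuousLinearMap.apply ℝ V (e i))

theorem matrixEntry_apply (e : HilbertBasis ι ℝ V) (j i : ι) (B : V →L[ℝ] V) :
    matrixEntry e j i B = inner ℝ (e j) (B (e i)) := by
  simp [matrixEntry]

/-- The `j`-th row of `B` consists of the coordinates of `B* e_j`, so Cauchy–Schwarz needs only the
operator norm. The bound does not depend on the finite set and serves as a dominating function. -/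
theorem sum_abs_matrixEntry_mul_le [CompleteSpace V] (e : HilbertBasis ι ℝ V) (j : ι)
    (B : V →L[ℝ] V) (w : V) (s : Finset ι) :
    ∑ i ∈ s, ‖inner ℝ (e j) (B (e i)) * inner ℝ (e i) w‖ ≤ ‖B‖ * ‖w‖ := by
  have h1 : ∑ i ∈ s, inner ℝ (e j) (B (e i)) ^ 2 ≤ ‖B‖ ^ 2 := by
    have h := e.hasSum_inner_sq (ContinuousLinearMap.adjoint B (e j))
    have h2 : ‖ContinuousLinearMap.adjoint B (e j)‖ ≤ ‖B‖ := by
      refine ((ContinuousLinearMap.adjoint B).le_opNorm _).trans_eq ?_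
      rw [e.orthonormal.1 j, mul_one]
      exact (ContinuousLinearMap.adjoint (𝕜 := ℝ) (E := V) (F := V)).norm_map B
    calc ∑ i ∈ s, inner ℝ (e j) (B (e i)) ^ 2
        = ∑ i ∈ s, inner ℝ (e i) (ContinuousLinearMap.adjoint B (e j)) ^ 2 := by
          refine Finset.sum_congr rfl fun i _ => ?_
          rw [ContinuousLinearMap.adjoint_inner_right, real_inner_comm]
      _ ≤ ‖ContinuousLinearMap.adjoint B (e j)‖ ^ 2 := sum_le_hasSum s (fun _ _ => sq_nonneg _) h
      _ ≤ ‖B‖ ^ 2 := by gcongr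
  have h2 : ∑ i ∈ s, inner ℝ (e i) w ^ 2 ≤ ‖w‖ ^ 2 :=
    sum_le_hasSum s (fun _ _ => sq_nonneg _) (e.hasSum_inner_sq w)
  have h3 := Finset.sum_mul_sq_le_sq_mul_sq s (fun i => ‖inner ℝ (e j) (B (e i))‖)
    (fun i => ‖inner ℝ (e i) w‖)
  simp only [Real.norm_eq_abs, sq_abs, ← abs_mul] at h3 ⊢
  refine le_of_sq_le_sq (h3.trans ?_) (by positivity)
  rw [mul_pow]
  exact mul_le_mul h1 h2 (Finset.sum_nonneg fun _ _ => sq_nonneg _) (sq_nonneg _)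

theorem hasSum_matrixEntry_mul [CompleteSpace V] (e : HilbertBasis ι ℝ V) (j : ι)
    (B : V →L[ℝ] V) (w : V) :
    HasSum (fun i => inner ℝ (e j) (B (e i)) * inner ℝ (e i) w) (inner ℝ (e j) (B w)) := by
  have h := e.hasSum_inner_mul_inner (ContinuousLinearMap.adjoint B (e j)) w
  simpa only [ContinuousLinearMap.adjoint_inner_left] using h

/-- The assumptions under which the pathwise integral is the Bochner integral of the product of the
vector valued fractional derivatives. -/
structure FracIntegrable (α s t : ℝ) (g : ℝ → V →L[ℝ] V) (ω : ℝ → V) : Prop where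
  left : ∀ r ∈ Ioo s t, IntervalIntegrable (leftFracKernelVec α g r) volume s r
  right : ∀ r ∈ Ioo s t, IntervalIntegrable (rightFracKernelVec α ω r) volume r t
  meas_left : AEStronglyMeasurable (leftFracDerivVec α s g) (volume.restrict (Ioo s t))
  meas_right : AEStronglyMeasurable (rightFracDerivVec α t ω) (volume.restrict (Ioo s t))
  integrable : IntervalIntegrable
    (fun r => ‖leftFracDerivVec α s g r‖ * ‖rightFracDerivVec α t ω r‖) volume s t

variable {α s t : ℝ} {g : ℝ → V →L[ℝ] V} {ω : ℝ → V}

theorem FracIntegrable.intervalIntegrable (h : FracIntegrable α s t g ω) (hst : s ≤ t) :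
    IntervalIntegrable (fun r => leftFracDerivVec α s g r (rightFracDerivVec α t ω r)) volume s t :=
  intervalIntegrable_of_norm_le_Ioo hst
    (isBoundedBilinearMap_apply.continuous.comp_aestronglyMeasurable
      (h.meas_left.prodMk h.meas_right)) h.integrable
    fun _ _ => ContinuousLinearMap.le_opNorm _ _

variable [CompleteSpace V]

theorem FracIntegrable.pathwiseIntegrand_eq (h : FracIntegrable α s t g ω) (e : HilbertBasis ι ℝ V)
    (j i : ι) {r : ℝ} (hr : r ∈ Ioo s t) : pathwiseIntegrand e α s t g ω j i r =
      inner ℝ (e j) (leftFracDerivVec α s g r (e i)) *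
        inner ℝ (e i) (rightFracDerivVec α t ω r) := by
  have h1 := leftFracDerivVec_clm (matrixEntry e j i) (h.left r hr)
  have h2 := rightFracDerivVec_clm (innerSL ℝ (e i)) (h.right r hr)
  simp only [matrixEntry_apply, leftFracDerivVec_real] at h1
  simp only [innerSL_apply_apply, rightFracDerivVec_real] at h2
  rw [pathwiseIntegrand, h1, h2]

theorem FracIntegrable.intervalIntegrable_pathwiseIntegrand (h : FracIntegrable α s t g ω)
    (hst : s ≤ t) (e : HilbertBasis ι ℝ V) (j i : ι) :
    IntervalIntegrable (pathwiseIntegrand e α s t g ω j i) volume s t := by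
  have h1 : IntervalIntegrable (fun r => inner ℝ (e j) (leftFracDerivVec α s g r (e i)) *
      inner ℝ (e i) (rightFracDerivVec α t ω r)) volume s t := by
    refine intervalIntegrable_of_norm_le_Ioo hst ?_ h.integrable fun r hr => ?_
    · have m1 := (matrixEntry e j i).continuous.comp_aestronglyMeasurable h.meas_left
      have m2 := (innerSL ℝ (e i)).continuous.comp_aestronglyMeasurable h.meas_right
      simp only [matrixEntry_apply] at m1
      exact m1.mul m2
    · simpa using sum_abs_matrixEntry_mul_le e j (leftFracDerivVec α s g r)
        (rightFracDerivVec α t ω r) {i}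
  rw [intervalIntegrable_iff_integrableOn_Ioo_of_le hst] at h1 ⊢
  exact h1.congr_fun (fun r hr => (h.pathwiseIntegrand_eq e j i hr).symm) measurableSet_Ioo

/-- The matrix bound dominates every finite sum of absolute values by the product of the norms.
Hence the `L¹` norms are summable, sum and integral commute, and the pointwise series collapses to
`(e_j, D g (D ω))`. -/
theorem FracIntegrable.hasSum_integral [Countable ι] (h : FracIntegrable α s t g ω) (hst : s ≤ t)
    (e : HilbertBasis ι ℝ V) (j : ι) :
    HasSum (fun i => ∫ r in s..t, pathwiseIntegrand e α s t g ω j i r)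
      (inner ℝ (e j) (∫ r in s..t, leftFracDerivVec α s g r (rightFracDerivVec α t ω r))) := by
  have hint : ∀ i, Integrable (pathwiseIntegrand e α s t g ω j i) (volume.restrict (Ioo s t)) :=
    fun i => (intervalIntegrable_iff_integrableOn_Ioo_of_le hst).1
      (h.intervalIntegrable_pathwiseIntegrand hst e j i)
  have hbound : Integrable (fun r => ‖leftFracDerivVec α s g r‖ * ‖rightFracDerivVec α t ω r‖)
      (volume.restrict (Ioo s t)) :=
    (intervalIntegrable_iff_integrableOn_Ioo_of_le hst).1 h.integrable
  have hsum : Summable fun i => ∫ r in Ioo s t, ‖pathwiseIntegrand e α s t g ω j i r‖ := by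
    refine summable_of_sum_le (fun i => integral_nonneg fun r => norm_nonneg _)
      (c := ∫ r in Ioo s t, ‖leftFracDerivVec α s g r‖ * ‖rightFracDerivVec α t ω r‖) fun u => ?_
    rw [← integral_finsetSum u fun i _ => (hint i).norm]
    refine setIntegral_mono_on (integrable_finsetSum u fun i _ => (hint i).norm) hbound
      measurableSet_Ioo fun r hr => ?_
    simp only [h.pathwiseIntegrand_eq e j _ hr]
    exact sum_abs_matrixEntry_mul_le e j _ _ u
  have hmain := hasSum_integral_of_summable_integral_norm hint hsum
  have e1 : ∫ r in Ioo s t, ∑' i, pathwiseIntegrand e α s t g ω j i r =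
      inner ℝ (e j) (∫ r in s..t, leftFracDerivVec α s g r (rightFracDerivVec α t ω r)) := by
    have := (innerSL ℝ (e j)).intervalIntegral_comp_comm (h.intervalIntegrable hst)
    simp only [innerSL_apply_apply] at this
    rw [← this, intervalIntegral.integral_of_le hst, integral_Ioc_eq_integral_Ioo]
    refine setIntegral_congr_fun measurableSet_Ioo fun r hr => ?_
    simp only [h.pathwiseIntegrand_eq e j _ hr]
    exact (hasSum_matrixEntry_mul e j _ _).tsum_eq
  rw [e1] at hmain
  refine hmain.congr_fun fun i => ?_
  rw [intervalIntegral.integral_of_le hst, integral_Ioc_eq_integral_Ioo]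

theorem FracIntegrable.pathwiseIntegrable [Countable ι] (h : FracIntegrable α s t g ω)
    (hst : s ≤ t) (e : HilbertBasis ι ℝ V) : PathwiseIntegrable e α s t g ω where
  left j i := ae_of_all _ fun r hr => by
    rw [← leftFracKernelVec_real]
    have := (matrixEntry e j i).integrable_comp (h.left r hr).1
    have h2 := (intervalIntegrable_iff_integrableOn_Ioc_of_le hr.1.le).2 this
    simpa only [← leftFracKernelVec_clm, matrixEntry_apply] using h2
  right i := ae_of_all _ fun r hr => by
    rw [← rightFracKernelVec_real]
    have := (innerSL ℝ (e i)).integrable_comp (h.right r hr).1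
    have h2 := (intervalIntegrable_iff_integrableOn_Ioc_of_le hr.2.le).2 this
    have h3 : rightFracKernelVec α (fun q => inner ℝ (e i) (ω q)) r =
        fun q => innerSL ℝ (e i) (rightFracKernelVec α ω r q) :=
      funext fun q => rightFracKernelVec_clm α (innerSL ℝ (e i)) ω r q
    rw [h3]
    exact h2
  integrable j i := h.intervalIntegrable_pathwiseIntegrand hst e j i
  summable_inner j := (h.hasSum_integral hst e j).summable
  summable_outer := by
    -- The inner sums are the coordinates of one Bochner integral, so the outer series is its basis
    -- expansion.
    simp only [(h.hasSum_integral hst e _).tsum_eq, ← HilbertBasis.repr_apply_apply]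
    exact (e.hasSum_repr _).summable

theorem FracIntegrable.pathwiseIntegral_eq [Countable ι] (h : FracIntegrable α s t g ω)
    (hst : s ≤ t) (e : HilbertBasis ι ℝ V) : pathwiseIntegral e α s t g ω =
      -∫ r in s..t, leftFracDerivVec α s g r (rightFracDerivVec α t ω r) := by
  simp only [pathwiseIntegral, (h.hasSum_integral hst e _).tsum_eq,
    ← HilbertBasis.repr_apply_apply]
  rw [(e.hasSum_repr _).tsum_eq]

end PathwiseIntegralEq

/-! ### Convolutions with the semigroup -/

/-- The target will be the operator space, which need not be separable; strong measurability comes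
from continuity on a subset of `ℝ`. -/
theorem stronglyMeasurable_indicator_of_continuousOn {E : Type*} [NormedAddCommGroup E]
    {f : ℝ → E} {s : Set ℝ} (hs : MeasurableSet s) (hf : ContinuousOn f s) :
    StronglyMeasurable (s.indicator f) := by
  obtain ⟨f', hf', he⟩ := (MeasurableEmbedding.subtype_coe hs).exists_stronglyMeasurable_extend
    (continuousOn_iff_continuous_domRestrict.1 hf).stronglyMeasurable (fun _ => ⟨0⟩)
  have : s.indicator f = s.indicator f' := by
    ext x
    by_cases hx : x ∈ s
    · rw [indicator_of_mem hx, indicator_of_mem hx]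
      exact (congrFun he ⟨x, hx⟩).symm
    · rw [indicator_of_notMem hx, indicator_of_notMem hx]
  rw [this]
  exact hf'.indicator hs

theorem leftFracDerivVec_congr {E : Type*} [NormedAddCommGroup E] [NormedSpace ℝ E]
    {α s r : ℝ} {f g : ℝ → E} (hsr : s < r) (h : ∀ q, s < q → q ≤ r → f q = g q) :
    leftFracDerivVec α s f r = leftFracDerivVec α s g r := by
  rw [leftFracDerivVec, leftFracDerivVec, h r hsr le_rfl]
  congr 3
  refine intervalIntegral_congr_Ioo hsr.le fun q hq => ?_
  rw [leftFracKernelVec, leftFracKernelVec, h r hsr le_rfl, h q hq.1 hq.2.le]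

/-- Operator valued functions with the regularity of `G ∘ u` for `u` in a weighted Hölder space. -/
structure IsSingularHolder {E : Type*} [NormedAddCommGroup E] (β M T : ℝ) (H : ℝ → E) : Prop where
  continuous : Continuous H
  nonneg : 0 ≤ M
  bound : ∀ r, 0 ≤ r → r ≤ T → ‖H r‖ ≤ M
  holder : ∀ q r, 0 < q → q ≤ r → r ≤ T → ‖H r - H q‖ ≤ M * (q ^ (-β) * (r - q) ^ β)

/-- Continuous functions that are Hölder continuous on `[0, T]`. -/
structure IsHolder {E : Type*} [NormedAddCommGroup E] (θ R T : ℝ) (w : ℝ → E) : Prop where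
  continuous : Continuous w
  nonneg : 0 ≤ R
  holder : ∀ q r, 0 ≤ q → q ≤ r → r ≤ T → ‖w q - w r‖ ≤ R * (r - q) ^ θ

section Convolution

variable {V : Type*} [NormedAddCommGroup V] [NormedSpace ℝ V]

/-- The integrand of a convolution with the semigroup. -/
def convIntegrand (S H : ℝ → V →L[ℝ] V) (t r : ℝ) : V →L[ℝ] V := (S (t - r)).comp (H r)

variable {S H : ℝ → V →L[ℝ] V} {P : V →L[ℝ] V} {α β γ δ m M T q r t : ℝ}

theorem continuousOn_convIntegrand (hS : IsSmoothingSemigroup S) (hH : Continuous H) (t : ℝ) :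
    ContinuousOn (convIntegrand S H t) (Iio t) := by
  refine ContinuousOn.clm_comp ?_ hH.continuousOn
  exact hS.continuousOn_Ioi.comp (continuousOn_const.sub continuousOn_id)
    fun r hr => sub_pos.2 (show r < t from hr)

/-- The operator `P` lets one estimate serve twice: `P = id` with `δ = 0`, `m = 1` gives plain
bounds, and `P = S h - id` with `m = h ^ δ` gives orbit bounds. -/
theorem norm_comp_convIntegrand_le (hH : IsSingularHolder β M T H)
    (hP : ∀ x, 0 < x → ‖P.comp (S x)‖ ≤ m * x ^ (-δ)) (hr : 0 ≤ r) (hrt : r < t) (ht : t ≤ T) :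
    ‖P.comp (convIntegrand S H t r)‖ ≤ m * M * (t - r) ^ (-δ) := by
  have hx : 0 < t - r := sub_pos.2 hrt
  calc ‖P.comp (convIntegrand S H t r)‖ = ‖(P.comp (S (t - r))).comp (H r)‖ := by
        rw [convIntegrand, ContinuousLinearMap.comp_assoc]
    _ ≤ ‖P.comp (S (t - r))‖ * ‖H r‖ := ContinuousLinearMap.opNorm_comp_le _ _
    _ ≤ (m * (t - r) ^ (-δ)) * M :=
        mul_le_mul (hP _ hx) (hH.bound r hr (by linarith)) (norm_nonneg _)
          ((norm_nonneg _).trans (hP _ hx))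
    _ = _ := by ring

/-- Split off `S (x / 2)`: this half absorbs `P`, the remaining half the time increment. The halving
costs `2 ^ (δ + γ) ≤ 4`. -/
theorem norm_comp_semigroup_sub_le (hS : IsSmoothingSemigroup S)
    (hP : ∀ x, 0 < x → ‖P.comp (S x)‖ ≤ m * x ^ (-δ)) (hm : 0 ≤ m) (hδ1 : δ ≤ 1)
    (hγ0 : 0 ≤ γ) (hγ1 : γ ≤ 1) {x h : ℝ} (hx : 0 < x) (hh : 0 ≤ h) :
    ‖P.comp (S (h + x) - S x)‖ ≤ 4 * m * x ^ (-δ - γ) * h ^ γ := by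
  have hx2 : 0 < x / 2 := by positivity
  have e1 : P.comp (S (h + x) - S x) =
      (P.comp (S (x / 2))).comp (S (h + x / 2) - S (x / 2)) := by
    rw [ContinuousLinearMap.comp_assoc, ContinuousLinearMap.comp_sub (S (x / 2)),
      ← hS.add _ _ hx2.le (by positivity), ← hS.add _ _ hx2.le hx2.le]
    congr 3 <;> ring
  have e2 : (x / 2) ^ (-δ) * (x / 2) ^ (-γ) ≤ 4 * x ^ (-δ - γ) := by
    rw [← Real.rpow_add hx2, Real.div_rpow hx.le zero_le_two, ← sub_eq_add_neg, div_eq_mul_inv,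
      ← Real.rpow_neg zero_le_two, mul_comm]
    gcongr
    calc (2 : ℝ) ^ (-(-δ - γ)) ≤ 2 ^ (2 : ℝ) :=
          Real.rpow_le_rpow_of_exponent_le one_le_two (by linarith)
      _ = 4 := by norm_num
  calc ‖P.comp (S (h + x) - S x)‖ ≤ ‖P.comp (S (x / 2))‖ * ‖S (h + x / 2) - S (x / 2)‖ := by
        rw [e1]
        exact ContinuousLinearMap.opNorm_comp_le _ _
    _ ≤ (m * (x / 2) ^ (-δ)) * (h ^ γ * (x / 2) ^ (-γ)) :=
        mul_le_mul (hP _ hx2) (hS.smoothing γ h _ hγ0 hγ1 hh hx2) (norm_nonneg _) (by positivity)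
    _ = m * h ^ γ * ((x / 2) ^ (-δ) * (x / 2) ^ (-γ)) := by ring
    _ ≤ m * h ^ γ * (4 * x ^ (-δ - γ)) := by gcongr
    _ = _ := by ring

theorem norm_comp_convIntegrand_sub_le (hS : IsSmoothingSemigroup S)
    (hH : IsSingularHolder β M T H)
    (hP : ∀ x, 0 < x → ‖P.comp (S x)‖ ≤ m * x ^ (-δ)) (hm : 0 ≤ m) (hδ1 : δ ≤ 1)
    (hγ0 : 0 ≤ γ) (hγ1 : γ ≤ 1) (hq : 0 < q) (hqr : q < r) (hrt : r < t) (ht : t ≤ T) :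
    ‖P.comp (convIntegrand S H t r) - P.comp (convIntegrand S H t q)‖ ≤
      m * M * (t - r) ^ (-δ) * (q ^ (-β) * (r - q) ^ β) +
        4 * m * M * (t - r) ^ (-δ - γ) * (r - q) ^ γ := by
  have hx : 0 < t - r := sub_pos.2 hrt
  have hM := hH.nonneg
  -- The increment of `H` is seen through `S (t - r)`, and the increment of the semigroup acts on `H
  -- q`; the latter trades `(r - q) ^ γ` for a stronger singularity at `t`.
  have e1 : P.comp (convIntegrand S H t r) - P.comp (convIntegrand S H t q) =
      (P.comp (S (t - r))).comp (H r - H q) -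
        (P.comp (S ((r - q) + (t - r)) - S (t - r))).comp (H q) := by
    rw [convIntegrand, convIntegrand, show (r - q) + (t - r) = t - q by ring]
    ext v
    simp
  rw [e1]
  refine (norm_sub_le _ _).trans (add_le_add ?_ ?_)
  · calc ‖(P.comp (S (t - r))).comp (H r - H q)‖ ≤ ‖P.comp (S (t - r))‖ * ‖H r - H q‖ :=
          ContinuousLinearMap.opNorm_comp_le _ _
      _ ≤ (m * (t - r) ^ (-δ)) * (M * (q ^ (-β) * (r - q) ^ β)) :=
          mul_le_mul (hP _ hx) (hH.holder q r hq hqr.le (by linarith)) (norm_nonneg _)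
            (by positivity)
      _ = _ := by ring
  · calc ‖(P.comp (S ((r - q) + (t - r)) - S (t - r))).comp (H q)‖
        ≤ ‖P.comp (S ((r - q) + (t - r)) - S (t - r))‖ * ‖H q‖ :=
          ContinuousLinearMap.opNorm_comp_le _ _
      _ ≤ (4 * m * (t - r) ^ (-δ - γ) * (r - q) ^ γ) * M := by
          have : 0 ≤ r - q := sub_nonneg.2 hqr.le
          exact mul_le_mul (norm_comp_semigroup_sub_le hS hP hm hδ1 hγ0 hγ1 hx this)
            (hH.bound q hq.le (by linarith)) (norm_nonneg _) (by positivity)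
      _ = _ := by ring

/-- The constant in the estimate of the left sided derivative of a convolution integrand. -/
def convConst (α β γ M T : ℝ) : ℝ :=
  1 / Real.Gamma (1 - α) * (M * (1 + α * betaConst (-β) (β - 1 - α) +
    α * (4 * (T ^ (γ - α) / (γ - α)))))

theorem convConst_nonneg (hα0 : 0 < α) (hαβ : α < β) (hβ : β < 1) (hαγ : α < γ) (hM : 0 ≤ M)
    (hT : 0 ≤ T) : 0 ≤ convConst α β γ M T := by
  have h1 := Real.Gamma_pos_of_pos (by linarith : 0 < 1 - α)
  have h2 := betaConst_nonneg (by linarith : -1 < -β) (by linarith : -1 < β - 1 - α)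
  have h3 : 0 < γ - α := by linarith
  unfold convConst
  positivity

theorem norm_comp_semigroup_id (hS : IsSmoothingSemigroup S) {x : ℝ} (hx : 0 < x) :
    ‖(ContinuousLinearMap.id ℝ V).comp (S x)‖ ≤ 1 * x ^ (-(0 : ℝ)) := by
  simpa using hS.norm_le_one x hx.le

theorem intervalIntegrable_leftFracKernelVec_convIntegrand (hS : IsSmoothingSemigroup S)
    (hH : IsSingularHolder β M T H) (hβ : β < 1) (hα0 : 0 < α) (hαβ : α < β)
    (hr : 0 < r) (hrt : r < t) (ht : t ≤ T) :
    IntervalIntegrable (leftFracKernelVec α (convIntegrand S H t) r) volume 0 r := by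
  -- Here `r < t` is fixed and only integrability matters, so `γ = β` will do.
  refine intervalIntegrable_leftFracKernelVec (β := β) (γ := β) (a₁ := 1 * M * (t - r) ^ (-(0 : ℝ)))
    (a₂ := 4 * 1 * M * (t - r) ^ (-(0 : ℝ) - β)) ?_ (fun q hq => ?_) hβ hαβ hαβ hr.le
  · exact ((continuousOn_convIntegrand hS hH.continuous t).mono
      fun q hq => hq.2.trans hrt).aestronglyMeasurable measurableSet_Ioo
  · have := norm_comp_convIntegrand_sub_le hS hH (P := ContinuousLinearMap.id ℝ V)
      (m := 1) (δ := 0) (fun x hx => norm_comp_semigroup_id hS hx) zero_le_one zero_le_one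
      (hα0.trans hαβ).le hβ.le hq.1 hq.2 hrt ht
    simpa only [ContinuousLinearMap.id_comp] using this

theorem norm_comp_leftFracDerivVec_convIntegrand_le [CompleteSpace V]
    (hS : IsSmoothingSemigroup S) (hH : IsSingularHolder β M T H)
    (hP : ∀ x, 0 < x → ‖P.comp (S x)‖ ≤ m * x ^ (-δ)) (hm : 0 ≤ m) (hδ1 : δ ≤ 1)
    (hγ1 : γ ≤ 1) (hβ : β < 1) (hα0 : 0 < α) (hαβ : α < β) (hαγ : α < γ)
    (hr : 0 < r) (hrt : r < t) (ht : t ≤ T) :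
    ‖P.comp (leftFracDerivVec α 0 (convIntegrand S H t) r)‖ ≤
      convConst α β γ M T * m * ((t - r) ^ (-δ) * (r ^ (-α) + (t - r) ^ (-γ))) := by
  have hx : 0 < t - r := sub_pos.2 hrt
  have hM := hH.nonneg
  have hG := Real.Gamma_pos_of_pos (by linarith : 0 < 1 - α)
  have hbb := betaConst_nonneg (by linarith : -1 < -β) (by linarith : -1 < β - 1 - α)
  have hγα : 0 < γ - α := by linarith
  have e1 := leftFracDerivVec_clm (ContinuousLinearMap.compL ℝ V V V P)
    (intervalIntegrable_leftFracKernelVec_convIntegrand hS hH hβ hα0 hαβ hr hrt ht)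
  simp only [ContinuousLinearMap.compL_apply] at e1
  rw [← e1]
  refine (norm_leftFracDerivVec_le (a₁ := m * M * (t - r) ^ (-δ))
    (norm_comp_convIntegrand_le hH hP hr.le hrt ht)
    (fun q hq => norm_comp_convIntegrand_sub_le hS hH hP hm hδ1 (hα0.trans hαγ).le hγ1 hq.1 hq.2
      hrt ht) (by positivity) hβ hα0 hαβ hαγ hr).trans ?_
  have e2 : convConst α β γ M T * m * ((t - r) ^ (-δ) * (r ^ (-α) + (t - r) ^ (-γ))) =
      1 / Real.Gamma (1 - α) * ((M * (1 + α * betaConst (-β) (β - 1 - α) +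
        α * (4 * (T ^ (γ - α) / (γ - α))))) *
          (m * ((t - r) ^ (-δ) * (r ^ (-α) + (t - r) ^ (-γ))))) := by
    rw [convConst]
    ring
  rw [e2]
  refine mul_le_mul_of_nonneg_left ?_ (by positivity)
  rw [sub_eq_add_neg (-δ), Real.rpow_add hx]
  have hrT : r ^ (γ - α) ≤ T ^ (γ - α) := Real.rpow_le_rpow hr.le (by linarith) hγα.le
  set X := (t - r) ^ (-δ)
  set Y := (t - r) ^ (-γ)
  set Z := r ^ (-α)
  set B := betaConst (-β) (β - 1 - α)
  have hX : 0 ≤ X := by positivity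
  have hY : 0 ≤ Y := by positivity
  have hZ : 0 ≤ Z := by positivity
  have hT0 : 0 ≤ T ^ (γ - α) := (Real.rpow_nonneg hr.le _).trans hrT
  calc m * M * X * Z + α * (m * M * X * (B * Z) + 4 * m * M * (X * Y) * (r ^ (γ - α) / (γ - α)))
      ≤ m * M * X * Z +
        α * (m * M * X * (B * Z) + 4 * m * M * (X * Y) * (T ^ (γ - α) / (γ - α))) := by gcongr
    -- The added nonnegative cross terms complete the expression to the product of `convConst` with
    -- `X * (Z + Y)`.
    _ ≤ m * M * X * Z +
        α * (m * M * X * (B * Z) + 4 * m * M * (X * Y) * (T ^ (γ - α) / (γ - α))) +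
        (m * M * X * Y * (1 + α * B) + m * M * X * Z * (α * (4 * (T ^ (γ - α) / (γ - α))))) :=
        le_add_of_nonneg_right (by positivity)
    _ = M * (1 + α * B + α * (4 * (T ^ (γ - α) / (γ - α)))) * (m * (X * (Z + Y))) := by ring

theorem norm_leftFracDerivVec_convIntegrand_le [CompleteSpace V]
    (hS : IsSmoothingSemigroup S) (hH : IsSingularHolder β M T H)
    (hγ1 : γ ≤ 1) (hβ : β < 1) (hα0 : 0 < α) (hαβ : α < β) (hαγ : α < γ)
    (hr : 0 < r) (hrt : r < t) (ht : t ≤ T) :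
    ‖leftFracDerivVec α 0 (convIntegrand S H t) r‖ ≤
      convConst α β γ M T * (r ^ (-α) + (t - r) ^ (-γ)) := by
  simpa using norm_comp_leftFracDerivVec_convIntegrand_le hS hH
    (fun x hx => norm_comp_semigroup_id hS hx) zero_le_one zero_le_one hγ1 hβ hα0 hαβ hαγ hr hrt ht

theorem aestronglyMeasurable_leftFracDerivVec_convIntegrand (hS : IsSmoothingSemigroup S)
    (hH : Continuous H) : AEStronglyMeasurable
      (leftFracDerivVec α 0 (convIntegrand S H t)) (volume.restrict (Ioo 0 t)) := by
  -- The semigroup is unspecified at negative times, so the integrand is cut off at `t`; the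
  -- derivative at `r < t` sees only earlier times.
  have h1 := aestronglyMeasurable_leftFracDerivVec (α := α) (s := 0)
    (stronglyMeasurable_indicator_of_continuousOn measurableSet_Iio
      (continuousOn_convIntegrand hS hH t))
  refine (h1.mono_measure (Measure.restrict_mono Ioo_subset_Ioi_self le_rfl)).congr ?_
  refine (ae_restrict_iff' measurableSet_Ioo).2 (ae_of_all _ fun r hr => ?_)
  refine leftFracDerivVec_congr hr.1 fun q _ hq => 
    indicator_of_mem (show q ∈ Iio t from hq.trans_lt hr.2) _

end Convolution

/-! ### Estimates of the fractional convolution and of its increments -/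

section FracConv

variable {V : Type*} [NormedAddCommGroup V] [InnerProductSpace ℝ V]

/-- The convolution `∫ D_{0+}^α (S (t - ·) H) D_{t-}^{1-α} w` of the semigroup with `H dw`, up to
its sign. -/
def fracConv (S H : ℝ → V →L[ℝ] V) (α : ℝ) (w : ℝ → V) (t : ℝ) : V :=
  ∫ r in (0 : ℝ)..t, leftFracDerivVec α 0 (convIntegrand S H t) r (rightFracDerivVec α t w r)

variable {S H : ℝ → V →L[ℝ] V} {P : V →L[ℝ] V} {w : ℝ → V} {α β γ δ θ ε m M R T r s t : ℝ}

theorem IsHolder.norm_rightFracDerivVec_le (hw : IsHolder θ R T w) (hα0 : 0 < α) (hα1 : α < 1)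
    (hα : 1 < θ + α) (hr : 0 ≤ r) (hrt : r < t) (ht : t ≤ T) :
    ‖rightFracDerivVec α t w r‖ ≤ rightFracConst α θ R * (t - r) ^ (θ + α - 1) :=
  _root_.norm_rightFracDerivVec_le (fun q h1 h2 => hw.holder r q hr h1 (h2.trans ht)) hα0 hα1 hα hrt

theorem sub_rpow_mul_sub_rpow (p q : ℝ) (hrt : r < t) :
    (t - r) ^ p * (t - r) ^ q = (t - r) ^ (p + q) :=
  (Real.rpow_add (sub_pos.2 hrt) p q).symm

theorem intervalIntegrable_add_rpow_mul_rpow {p : ℝ} (hα1 : α < 1) (hp : -1 < p) (hpγ : γ < p + 1)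
    (hst : s ≤ t) : IntervalIntegrable
      (fun r : ℝ => (r - s) ^ (-α) * (t - r) ^ p + (t - r) ^ (p - γ)) volume s t :=
  (intervalIntegrable_rpow_mul_rpow (by linarith) hp hst).add
    (intervalIntegrable_rsub_rpow (by linarith) s t t)

theorem integral_add_rpow_mul_rpow_le {p : ℝ} (hα1 : α < 1) (hp : -1 < p) (hpγ : γ < p + 1)
    (hst : s < t) : ∫ r in s..t, ((r - s) ^ (-α) * (t - r) ^ p + (t - r) ^ (p - γ)) ≤
      betaConst (-α) p * (t - s) ^ (p + 1 - α) + (t - s) ^ (p + 1 - γ) / (p + 1 - γ) := by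
  rw [intervalIntegral.integral_add (intervalIntegrable_rpow_mul_rpow (by linarith) hp hst.le)
    (intervalIntegrable_rsub_rpow (by linarith) s t t), integral_rsub_rpow (by linarith)]
  refine add_le_add ((integral_rpow_mul_rpow_le (by linarith) hp hst).trans_eq ?_) (le_of_eq ?_)
  · congr 2
    ring
  · rw [show p - γ + 1 = p + 1 - γ by ring]

variable [CompleteSpace V]

theorem fracIntegrable_convIntegrand (hS : IsSmoothingSemigroup S)
    (hH : IsSingularHolder β M T H) (hw : IsHolder θ R T w) (hα0 : 0 < α) (hαβ : α < β)
    (hβ : β < 1) (hα : 1 < θ + α) (ht0 : 0 ≤ t) (ht : t ≤ T) :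
    FracIntegrable α 0 t (convIntegrand S H t) w where
  left r hr := intervalIntegrable_leftFracKernelVec_convIntegrand hS hH hβ hα0 hαβ hr.1 hr.2 ht
  right r hr := intervalIntegrable_rightFracKernelVec hw.continuous.stronglyMeasurable
    (fun q h1 h2 => hw.holder r q hr.1.le h1 (h2.trans ht)) hα hr.2.le
  meas_left := aestronglyMeasurable_leftFracDerivVec_convIntegrand hS hH.continuous
  meas_right := (aestronglyMeasurable_rightFracDerivVec
    hw.continuous.stronglyMeasurable).mono_measure
      (Measure.restrict_mono Ioo_subset_Iio_self le_rfl)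
  integrable := by
    have hT : 0 ≤ T := ht0.trans ht
    have hc := convConst_nonneg hα0 hαβ hβ hαβ hH.nonneg hT
    refine intervalIntegrable_of_norm_le_Ioo ht0 ?_
      ((intervalIntegrable_add_rpow_mul_rpow (α := α) (γ := β) (p := θ + α - 1) (by linarith)
        (by linarith) (by linarith) ht0).const_mul
          (convConst α β β M T * rightFracConst α θ R)) fun r hr => ?_
    · exact (aestronglyMeasurable_leftFracDerivVec_convIntegrand hS hH.continuous).norm.mul
        (((aestronglyMeasurable_rightFracDerivVec hw.continuous.stronglyMeasurable).mono_measure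
          (Measure.restrict_mono Ioo_subset_Iio_self le_rfl)).norm)
    · have h1 := norm_leftFracDerivVec_convIntegrand_le hS hH hβ.le hβ hα0 hαβ hαβ hr.1 hr.2 ht
      have h2 := hw.norm_rightFracDerivVec_le hα0 (hαβ.trans hβ) hα hr.1.le hr.2 ht
      rw [norm_mul, norm_norm, norm_norm]
      refine (mul_le_mul h1 h2 (norm_nonneg _) ((norm_nonneg _).trans h1)).trans_eq ?_
      rw [sub_eq_add_neg _ β, ← sub_rpow_mul_sub_rpow _ _ hr.2, sub_zero]
      ring

/-- The right sided derivative contributes `(t - r) ^ (θ + α - 1)`, which pays for both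
singularities `δ` and `γ` exactly when `γ + δ < θ + α`. As `γ` may approach `α`, every `δ < θ` is
within reach. -/
theorem norm_apply_fracConv_le (hS : IsSmoothingSemigroup S) (hH : IsSingularHolder β M T H) (hw : IsHolder θ R T w)
    (hP : ∀ x, 0 < x → ‖P.comp (S x)‖ ≤ m * x ^ (-δ)) (hm : 0 ≤ m) (hδ1 : δ ≤ 1)
    (hα0 : 0 < α) (hαβ : α < β) (hβ : β < 1) (hα : 1 < θ + α) (hαγ : α < γ) (hγ1 : γ ≤ 1)
    (hγδ : γ + δ < θ + α) (ht0 : 0 ≤ t) (ht : t ≤ T) :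
    ‖P (fracConv S H α w t)‖ ≤ convConst α β γ M T * rightFracConst α θ R *
      (betaConst (-α) (θ + α - 1 - δ) * T ^ (θ - δ) +
        T ^ (θ + α - δ - γ) / (θ + α - δ - γ)) * m := by
  have hT : 0 ≤ T := ht0.trans ht
  have hc := convConst_nonneg hα0 hαβ hβ hαγ hH.nonneg hT
  have hc' := rightFracConst_nonneg hα0 (hαβ.trans hβ) hα hw.nonneg
  have hp : -1 < θ + α - 1 - δ := by linarith
  have hb := betaConst_nonneg (by linarith : -1 < -α) hp
  have hd : 0 < θ + α - δ - γ := by linarith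
  rcases ht0.eq_or_lt with rfl | htpos
  · simp only [fracConv, intervalIntegral.integral_same, map_zero, norm_zero]
    positivity
  have hint := (fracIntegrable_convIntegrand hS hH hw hα0 hαβ hβ hα ht0 ht).intervalIntegrable ht0
  rw [fracConv, ← P.intervalIntegral_comp_comm hint]
  refine (norm_intervalIntegral_le_of_Ioo ht0 (g := fun r => convConst α β γ M T *
    rightFracConst α θ R * m * ((r - 0) ^ (-α) * (t - r) ^ (θ + α - 1 - δ) +
      (t - r) ^ (θ + α - 1 - δ - γ))) (fun r hr => ?_)
    ((intervalIntegrable_add_rpow_mul_rpow (by linarith) hp (by linarith) ht0).const_mul _)).trans ?_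
  · have h1 := norm_comp_leftFracDerivVec_convIntegrand_le hS hH hP hm hδ1 hγ1 hβ hα0 hαβ hαγ
      hr.1 hr.2 ht
    have h2 := hw.norm_rightFracDerivVec_le hα0 (hαβ.trans hβ) hα hr.1.le hr.2 ht
    calc ‖P (leftFracDerivVec α 0 (convIntegrand S H t) r (rightFracDerivVec α t w r))‖
        ≤ ‖P.comp (leftFracDerivVec α 0 (convIntegrand S H t) r)‖ * ‖rightFracDerivVec α t w r‖ :=
          (P.comp (leftFracDerivVec α 0 (convIntegrand S H t) r)).le_opNorm _
      _ ≤ _ := mul_le_mul h1 h2 (norm_nonneg _) ((norm_nonneg _).trans h1)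
      _ = _ := by
        rw [sub_eq_add_neg _ γ, ← sub_rpow_mul_sub_rpow _ (-γ) hr.2, sub_eq_add_neg _ δ,
          ← sub_rpow_mul_sub_rpow _ (-δ) hr.2, sub_zero]
        ring
  · rw [intervalIntegral.integral_const_mul]
    have h3 := integral_add_rpow_mul_rpow_le (α := α) (γ := γ) (by linarith) hp (by linarith) htpos
    rw [sub_zero, show θ + α - 1 - δ + 1 - α = θ - δ by ring,
      show θ + α - 1 - δ + 1 - γ = θ + α - δ - γ by ring] at h3
    have h4 : t ^ (θ - δ) ≤ T ^ (θ - δ) := Real.rpow_le_rpow ht0 ht (by linarith)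
    have h5 : t ^ (θ + α - δ - γ) ≤ T ^ (θ + α - δ - γ) := Real.rpow_le_rpow ht0 ht hd.le
    calc _ ≤ convConst α β γ M T * rightFracConst α θ R * m *
          (betaConst (-α) (θ + α - 1 - δ) * T ^ (θ - δ) +
            T ^ (θ + α - δ - γ) / (θ + α - δ - γ)) := by
          refine mul_le_mul_of_nonneg_left (h3.trans ?_) (by positivity)
          gcongr
      _ = _ := by ring

/-- For `q ≤ r < s` the semigroup law factors `S (t - s)` out of `S (t - q)`, and the left
derivative at `r` only looks at such `q`. -/
theorem leftFracDerivVec_convIntegrand_eq (hS : IsSmoothingSemigroup S)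
    (hH : IsSingularHolder β M T H) (hα0 : 0 < α) (hαβ : α < β) (hβ : β < 1)
    (hr : 0 < r) (hrs : r < s) (hst : s ≤ t) (hs : s ≤ T) :
    leftFracDerivVec α 0 (convIntegrand S H t) r =
      (S (t - s)).comp (leftFracDerivVec α 0 (convIntegrand S H s) r) := by
  have e1 := leftFracDerivVec_clm (ContinuousLinearMap.compL ℝ V V V (S (t - s)))
    (intervalIntegrable_leftFracKernelVec_convIntegrand hS hH hβ hα0 hαβ hr hrs hs)
  simp only [ContinuousLinearMap.compL_apply] at e1
  rw [← e1]
  refine leftFracDerivVec_congr hr fun q hq hqr => ?_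
  rw [convIntegrand, convIntegrand, ← ContinuousLinearMap.comp_assoc,
    ← hS.add _ _ (by linarith) (by linarith)]
  congr 2
  ring

/-- Three effects: the semigroup acts on the value at `s`, new input arrives on `[s, t]`, and the
right sided derivative changes its terminal time from `s` to `t`. The last one is a memory term on
`[0, s]`, absent from ordinary convolutions. -/
theorem fracConv_sub (hS : IsSmoothingSemigroup S)
    (hH : IsSingularHolder β M T H) (hw : IsHolder θ R T w) (hα0 : 0 < α) (hαβ : α < β)
    (hβ : β < 1) (hα : 1 < θ + α) (hs : 0 ≤ s) (hst : s ≤ t) (ht : t ≤ T) :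
    fracConv S H α w t - fracConv S H α w s = (S (t - s) (fracConv S H α w s) - fracConv S H α w s) +
      (∫ r in s..t, leftFracDerivVec α 0 (convIntegrand S H t) r (rightFracDerivVec α t w r)) +
      ∫ r in (0 : ℝ)..s, leftFracDerivVec α 0 (convIntegrand S H t) r
        (rightFracDerivVec α t w r - rightFracDerivVec α s w r) := by
  have it := (fracIntegrable_convIntegrand hS hH hw hα0 hαβ hβ hα (hs.trans hst) ht).intervalIntegrable
    (hs.trans hst)
  have is := (fracIntegrable_convIntegrand hS hH hw hα0 hαβ hβ hα hs
    (hst.trans ht)).intervalIntegrable hs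
  have it1 := it.mono_set (uIcc_subset_uIcc left_mem_uIcc (mem_uIcc_of_le hs hst))
  have it2 := it.mono_set (uIcc_subset_uIcc (mem_uIcc_of_le hs hst) right_mem_uIcc)
  have hSs : IntervalIntegrable (fun r => S (t - s) (leftFracDerivVec α 0 (convIntegrand S H s) r
      (rightFracDerivVec α s w r))) volume 0 s :=
    ⟨(S (t - s)).integrable_comp is.1, (S (t - s)).integrable_comp is.2⟩
  have e1 : ∫ r in (0 : ℝ)..s, leftFracDerivVec α 0 (convIntegrand S H t) r
        (rightFracDerivVec α t w r - rightFracDerivVec α s w r) =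
      (∫ r in (0 : ℝ)..s, leftFracDerivVec α 0 (convIntegrand S H t) r
        (rightFracDerivVec α t w r)) - S (t - s) (fracConv S H α w s) := by
    rw [fracConv, ← (S (t - s)).intervalIntegral_comp_comm is,
      ← intervalIntegral.integral_sub it1 hSs]
    refine intervalIntegral_congr_Ioo hs fun r hr => ?_
    rw [map_sub]
    congr 1
    rw [leftFracDerivVec_convIntegrand_eq hS hH hα0 hαβ hβ hr.1 hr.2 hst (hst.trans ht)]
    rfl
  rw [e1, fracConv, ← intervalIntegral.integral_add_adjacent_intervals it1 it2]
  abel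

theorem norm_integral_increment_le (hS : IsSmoothingSemigroup S)
    (hH : IsSingularHolder β M T H) (hw : IsHolder θ R T w) (hα0 : 0 < α) (hαβ : α < β)
    (hβ : β < 1) (hα : 1 < θ + α) (hαγ : α < γ) (hγ1 : γ ≤ 1)
    (hs : 0 ≤ s) (hst : s < t) (ht : t ≤ T) :
    ‖∫ r in s..t, leftFracDerivVec α 0 (convIntegrand S H t) r (rightFracDerivVec α t w r)‖ ≤
      convConst α β γ M T * rightFracConst α θ R *
        (betaConst (-α) (θ + α - 1) * (t - s) ^ θ +
          (t - s) ^ (θ + α - γ) / (θ + α - γ)) := by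
  have hT : 0 ≤ T := by linarith
  have hc := convConst_nonneg hα0 hαβ hβ hαγ hH.nonneg hT
  have hc' := rightFracConst_nonneg hα0 (hαβ.trans hβ) hα hw.nonneg
  have hp : -1 < θ + α - 1 := by linarith
  refine (norm_intervalIntegral_le_of_Ioo hst.le (g := fun r => convConst α β γ M T *
    rightFracConst α θ R * ((r - s) ^ (-α) * (t - r) ^ (θ + α - 1) +
      (t - r) ^ (θ + α - 1 - γ))) (fun r hr => ?_)
    ((intervalIntegrable_add_rpow_mul_rpow (by linarith) hp (by linarith) hst.le).const_mul _)).trans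
      ?_
  · have hr0 : 0 < r := hs.trans_lt hr.1
    have h1 := norm_leftFracDerivVec_convIntegrand_le hS hH hγ1 hβ hα0 hαβ hαγ hr0 hr.2 ht
    have h2 := hw.norm_rightFracDerivVec_le hα0 (hαβ.trans hβ) hα hr0.le hr.2 ht
    -- Moving the singularity from `0` to `s` makes the estimate uniform in `s`, so a weight at time
    -- zero is not needed.
    have h3 : r ^ (-α) ≤ (r - s) ^ (-α) :=
      Real.rpow_le_rpow_of_nonpos (sub_pos.2 hr.1) (by linarith) (by linarith)
    have h4 : 0 ≤ (t - r) ^ (θ + α - 1) := Real.rpow_nonneg (sub_nonneg.2 hr.2.le) _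
    calc _ ≤ ‖leftFracDerivVec α 0 (convIntegrand S H t) r‖ * ‖rightFracDerivVec α t w r‖ :=
          ContinuousLinearMap.le_opNorm _ _
      _ ≤ _ := mul_le_mul h1 h2 (norm_nonneg _) ((norm_nonneg _).trans h1)
      _ ≤ (convConst α β γ M T * ((r - s) ^ (-α) + (t - r) ^ (-γ))) *
          (rightFracConst α θ R * (t - r) ^ (θ + α - 1)) := by gcongr
      _ = _ := by
        rw [sub_eq_add_neg _ γ, ← sub_rpow_mul_sub_rpow _ _ hr.2]
        ring
  · rw [intervalIntegral.integral_const_mul]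
    have h3 := integral_add_rpow_mul_rpow_le (α := α) (γ := γ) (by linarith) hp (by linarith) hst
    rw [show θ + α - 1 + 1 - α = θ by ring, show θ + α - 1 + 1 - γ = θ + α - γ by ring] at h3
    gcongr

/-- Bounding `(t - r) ^ (-(α + ε))` by the same power of `s - r` would leave a nonintegrable `(s -
r) ^ (-1 - ε)`. Part of it is paid with `t - s` instead, and this is where the order drops from `θ`
to `θ - 2ε`. -/
theorem norm_integral_memory_le (hS : IsSmoothingSemigroup S)
    (hH : IsSingularHolder β M T H) (hw : IsHolder θ R T w) (hα0 : 0 < α) (hαβ : α < β)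
    (hβ : β < 1) (hα : 1 < θ + α) (hθ : 0 ≤ θ) (hε : 0 < ε) (hεα : ε ≤ α) (hγ1 : α + ε ≤ 1)
    (hs : 0 < s) (hst : s < t) (ht : t ≤ T) :
    ‖∫ r in (0 : ℝ)..s, leftFracDerivVec α 0 (convIntegrand S H t) r
        (rightFracDerivVec α t w r - rightFracDerivVec α s w r)‖ ≤
      convConst α β (α + ε) M T * (1 / Real.Gamma α * R) *
        (betaConst (-α) (α - 1) * (t - s) ^ θ + (t - s) ^ (θ - 2 * ε) * (s ^ ε / ε)) := by
  have hT : 0 ≤ T := by linarith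
  have hc := convConst_nonneg hα0 hαβ hβ (by linarith : α < α + ε) hH.nonneg hT
  have hG := Real.Gamma_pos_of_pos hα0
  have hR := hw.nonneg
  have hh : 0 < t - s := sub_pos.2 hst
  have i1 := (intervalIntegrable_rpow_mul_rpow (by linarith : -1 < -α) (by linarith : -1 < α - 1)
    hs.le).const_mul ((t - s) ^ θ)
  have i2 := (intervalIntegrable_rsub_rpow (by linarith : -1 < ε - 1) 0 s s).const_mul
    ((t - s) ^ (θ - 2 * ε))
  refine (norm_intervalIntegral_le_of_Ioo hs.le (g := fun r => convConst α β (α + ε) M T *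
    (1 / Real.Gamma α * R) * ((t - s) ^ θ * ((r - 0) ^ (-α) * (s - r) ^ (α - 1)) +
      (t - s) ^ (θ - 2 * ε) * (s - r) ^ (ε - 1))) (fun r hr => ?_)
    ((i1.add i2).const_mul _)).trans ?_
  · have hrs : 0 < s - r := sub_pos.2 hr.2
    have htr : 0 < t - r := by linarith
    have h1 := norm_leftFracDerivVec_convIntegrand_le hS hH hγ1 hβ hα0 hαβ
      (by linarith : α < α + ε) hr.1 (hr.2.trans hst) ht
    have h2 := norm_rightFracDerivVec_sub_le hw.continuous.stronglyMeasurable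
      (fun q h1 h2 => hw.holder r q hr.1.le h1 (h2.trans ht))
      (fun q h1 h2 => hw.holder s q hs.le h1 (h2.trans ht)) hR hθ hα0 (hαβ.trans hβ) hα hr.2 hst.le
    -- Both `t - s` and `s - r` are at most `t - r`. The power `ε - α` left on `s - r` combines with
    -- `α - 1` to the integrable `ε - 1`.
    have h3 : (t - r) ^ (-(α + ε)) ≤ (t - s) ^ (-(2 * ε)) * (s - r) ^ (ε - α) := by
      rw [show -(α + ε) = -(2 * ε) + (ε - α) by ring, Real.rpow_add htr]
      exact mul_le_mul (Real.rpow_le_rpow_of_nonpos hh (by linarith [hr.2]) (by linarith))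
        (Real.rpow_le_rpow_of_nonpos hrs (by linarith) (by linarith)) (by positivity)
        (by positivity)
    calc _ ≤ ‖leftFracDerivVec α 0 (convIntegrand S H t) r‖ *
            ‖rightFracDerivVec α t w r - rightFracDerivVec α s w r‖ :=
          ContinuousLinearMap.le_opNorm _ _
      _ ≤ _ := mul_le_mul h1 h2 (norm_nonneg _) ((norm_nonneg _).trans h1)
      _ ≤ (convConst α β (α + ε) M T * (r ^ (-α) + (t - s) ^ (-(2 * ε)) * (s - r) ^ (ε - α))) *
          (1 / Real.Gamma α * (R * (t - s) ^ θ * (s - r) ^ (α - 1))) := by gcongr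
      _ = _ := by
        rw [show ε - 1 = (ε - α) + (α - 1) by ring, Real.rpow_add hrs, sub_eq_add_neg θ,
          Real.rpow_add hh, sub_zero]
        ring
  · rw [intervalIntegral.integral_const_mul, intervalIntegral.integral_add i1 i2,
      intervalIntegral.integral_const_mul, intervalIntegral.integral_const_mul,
      integral_rsub_rpow (by linarith : -1 < ε - 1), sub_zero, show ε - 1 + 1 = ε by ring]
    -- This Beta integral is scale invariant: the total exponent of `s` is zero.
    have h3 := integral_rpow_mul_rpow_le (by linarith : -1 < -α) (by linarith : -1 < α - 1) hs
    rw [sub_zero, show -α + (α - 1) + 1 = 0 by ring, Real.rpow_zero, mul_one] at h3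
    rw [mul_comm (betaConst _ _)]
    gcongr

end FracConv

/-! ### Uniform orbit regularity and compactness in `V` -/

section Regularity

variable {V : Type*} [NormedAddCommGroup V] [InnerProductSpace ℝ V]
  {S : ℝ → V →L[ℝ] V}

theorem rpow_le_rpow_mul {h T a b : ℝ} (hh : 0 < h) (hT : h ≤ T) (hab : b ≤ a) :
    h ^ a ≤ T ^ (a - b) * h ^ b := by
  rw [show a = (a - b) + b by ring, Real.rpow_add hh, add_sub_cancel_right]
  gcongr

/-- Time regularity of a path `J` on `[0, T]`, and its approximability by the semigroup, both of
order `δ`. -/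
structure HasOrbitRegularity (S : ℝ → V →L[ℝ] V) (δ C T : ℝ) (J : ℝ → V) : Prop where
  smooth : ∀ h s, 0 ≤ h → 0 ≤ s → s ≤ T → ‖S h (J s) - J s‖ ≤ C * h ^ δ
  holder : ∀ s t, 0 ≤ s → s < t → t ≤ T → ‖J t - J s‖ ≤ C * (t - s) ^ δ

theorem HasOrbitRegularity.sub {δ C C' T : ℝ} {J J' : ℝ → V} (h : HasOrbitRegularity S δ C T J)
    (h' : HasOrbitRegularity S δ C' T J') :
    HasOrbitRegularity S δ (C + C') T (fun t => J t - J' t) where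
  smooth x s hx hs hsT := by
    rw [map_sub, sub_sub_sub_comm, add_mul]
    exact (norm_sub_le _ _).trans (add_le_add (h.smooth x s hx hs hsT) (h'.smooth x s hx hs hsT))
  holder s t hs hst ht := by
    rw [sub_sub_sub_comm, add_mul]
    exact (norm_sub_le _ _).trans (add_le_add (h.holder s t hs hst ht) (h'.holder s t hs hst ht))

theorem intervalIntegrable_semigroup_apply (hS : IsSmoothingSemigroup S) {φ : ℝ → V}
    (hφ : Continuous φ) {N T t : ℝ} (hN : ∀ r, 0 ≤ r → r ≤ T → ‖φ r‖ ≤ N) (ht0 : 0 ≤ t) (ht : t ≤ T) :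
    IntervalIntegrable (fun r => S (t - r) (φ r)) volume 0 t := by
  refine intervalIntegrable_of_norm_le_Ioo ht0 (g := fun _ => N) ?_ intervalIntegrable_const
    fun r hr => ?_
  · refine ContinuousOn.aestronglyMeasurable (ContinuousOn.clm_apply ?_ hφ.continuousOn)
      measurableSet_Ioo
    exact hS.continuousOn_Ioi.comp (continuousOn_const.sub continuousOn_id)
      fun r hr => sub_pos.2 hr.2
  · exact (hS.norm_apply_le (sub_nonneg.2 hr.2.le) _).trans (hN r hr.1.le (hr.2.le.trans ht))

variable [CompleteSpace V]

/-- The constant is chosen before `H` and `w`; this uniformity is what compactness needs. With `γ =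
α + ε` the increment term loses `ε` and the memory term `2ε`; the orbit term uses `γ + δ = θ + α -
ε`. -/
theorem exists_hasOrbitRegularity_fracConv (hS : IsSmoothingSemigroup S) {α β θ ε M R T : ℝ}
    (hα0 : 0 < α) (hαβ : α < β) (hβ : β < 1) (hα : 1 < θ + α) (hθ1 : θ ≤ 1) (hε : 0 < ε)
    (hεα : ε ≤ α) (hγ1 : α + ε ≤ 1) (hεθ : 2 * ε ≤ θ) (hM : 0 ≤ M) (hR : 0 ≤ R) (hT : 0 ≤ T) :
    ∃ C, 0 ≤ C ∧ ∀ (H : ℝ → V →L[ℝ] V) (w : ℝ → V), IsSingularHolder β M T H → IsHolder θ R T w →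
      HasOrbitRegularity S (θ - 2 * ε) C T (fracConv S H α w) := by
  have hc := convConst_nonneg hα0 hαβ hβ (by linarith : α < α + ε) hM hT
  have hc' := rightFracConst_nonneg hα0 (hαβ.trans hβ) hα hR
  have hG := Real.Gamma_pos_of_pos hα0
  have hb1 := betaConst_nonneg (by linarith : -1 < -α)
    (by linarith : -1 < θ + α - 1 - (θ - 2 * ε))
  have hb2 := betaConst_nonneg (by linarith : -1 < -α) (by linarith : -1 < θ + α - 1)
  have hb3 := betaConst_nonneg (by linarith : -1 < -α) (by linarith : -1 < α - 1)
  have hd1 : 0 < θ + α - (θ - 2 * ε) - (α + ε) := by linarith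
  have hd2 : 0 < θ + α - (α + ε) := by linarith
  set C₁ := convConst α β (α + ε) M T * rightFracConst α θ R *
      (betaConst (-α) (θ + α - 1 - (θ - 2 * ε)) * T ^ (θ - (θ - 2 * ε)) +
        T ^ (θ + α - (θ - 2 * ε) - (α + ε)) / (θ + α - (θ - 2 * ε) - (α + ε))) with hC₁
  set C₂ := convConst α β (α + ε) M T * rightFracConst α θ R *
      (betaConst (-α) (θ + α - 1) * T ^ (2 * ε) + T ^ ε / (θ + α - (α + ε))) with hC₂
  set C₃ := convConst α β (α + ε) M T * (1 / Real.Gamma α * R) *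
        (betaConst (-α) (α - 1) * T ^ (2 * ε) + T ^ ε / ε) with hC₃
  have hC₁0 : 0 ≤ C₁ := by positivity
  have hC₂0 : 0 ≤ C₂ := by positivity
  have hC₃0 : 0 ≤ C₃ := by positivity
  refine ⟨C₁ + C₂ + C₃, by positivity, fun H w hH hw => ?_⟩
  have key1 : ∀ h s, 0 ≤ h → 0 ≤ s → s ≤ T →
      ‖S h (fracConv S H α w s) - fracConv S H α w s‖ ≤ C₁ * h ^ (θ - 2 * ε) := by
    intro h s hh hs hsT
    refine norm_apply_fracConv_le (P := S h - ContinuousLinearMap.id ℝ V) (δ := θ - 2 * ε) hS hH hw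
      (fun x hx => ?_) (by positivity) (by linarith) hα0 hαβ hβ hα (by linarith) hγ1
      (by linarith) hs hsT
    rw [hS.sub_id_comp hh hx.le]
    exact hS.smoothing _ h x (by linarith) (by linarith) hh hx
  refine ⟨fun h s hh hs hsT => (key1 h s hh hs hsT).trans ?_, fun s t hs hst ht => ?_⟩
  · gcongr
    linarith
  have hh : 0 < t - s := sub_pos.2 hst
  have hhT : t - s ≤ T := by linarith
  have hp : 0 ≤ (t - s) ^ (θ - 2 * ε) := by positivity
  have e1 : (t - s) ^ θ ≤ T ^ (2 * ε) * (t - s) ^ (θ - 2 * ε) := by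
    simpa using rpow_le_rpow_mul (a := θ) (b := θ - 2 * ε) hh hhT (by linarith)
  have e2 : (t - s) ^ (θ + α - (α + ε)) ≤ T ^ ε * (t - s) ^ (θ - 2 * ε) := by
    have := rpow_le_rpow_mul (a := θ + α - (α + ε)) (b := θ - 2 * ε) hh hhT (by linarith)
    rwa [show θ + α - (α + ε) - (θ - 2 * ε) = ε by ring] at this
  have key2 : ‖∫ r in s..t, leftFracDerivVec α 0 (convIntegrand S H t) r
      (rightFracDerivVec α t w r)‖ ≤ C₂ * (t - s) ^ (θ - 2 * ε) := by
    refine (norm_integral_increment_le hS hH hw hα0 hαβ hβ hα (by linarith : α < α + ε) hγ1 hs hst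
      ht).trans ?_
    rw [hC₂, mul_assoc _ _ ((t - s) ^ (θ - 2 * ε)), add_mul, mul_assoc (betaConst _ _),
      div_mul_eq_mul_div]
    gcongr
  have key3 : ‖∫ r in (0 : ℝ)..s, leftFracDerivVec α 0 (convIntegrand S H t) r
        (rightFracDerivVec α t w r - rightFracDerivVec α s w r)‖ ≤
      C₃ * (t - s) ^ (θ - 2 * ε) := by
    rcases hs.eq_or_lt with rfl | hs
    · rw [intervalIntegral.integral_same, norm_zero]
      positivity
    refine (norm_integral_memory_le hS hH hw hα0 hαβ hβ hα (by linarith) hε hεα hγ1 hs hst ht).trans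
      ?_
    rw [hC₃, mul_assoc _ _ ((t - s) ^ (θ - 2 * ε)), add_mul, mul_assoc (betaConst _ _),
      mul_comm ((t - s) ^ (θ - 2 * ε))]
    gcongr
    linarith
  rw [fracConv_sub hS hH hw hα0 hαβ hβ hα hs hst.le ht, add_mul, add_mul]
  exact norm_add₃_le.trans (add_le_add (add_le_add
    (key1 _ s hh.le hs (by linarith)) key2) key3)

/-! ### Convolution of the semigroup with a bounded function -/

/-- The convolution `∫ S(t - r) φ(r) dr`. -/
def semigroupConv (S : ℝ → V →L[ℝ] V) (φ : ℝ → V) (t : ℝ) : V :=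
  ∫ r in (0 : ℝ)..t, S (t - r) (φ r)

/-- Smoothing costs `(s - r) ^ (-δ)`, integrable for every `δ < 1`, so boundedness of `φ` suffices.
-/
theorem exists_hasOrbitRegularity_semigroupConv (hS : IsSmoothingSemigroup S) {δ N T : ℝ}
    (hδ0 : 0 ≤ δ) (hδ1 : δ < 1) (hN0 : 0 ≤ N) (hT : 0 ≤ T) :
    ∃ C, 0 ≤ C ∧ ∀ φ : ℝ → V, Continuous φ → (∀ r, 0 ≤ r → r ≤ T → ‖φ r‖ ≤ N) →
      HasOrbitRegularity S δ C T (semigroupConv S φ) := by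
  have hd : 0 < 1 - δ := by linarith
  set C₁ := N * (T ^ (1 - δ) / (1 - δ)) with hC₁
  set C₂ := N * T ^ (1 - δ) with hC₂
  have hC₁0 : 0 ≤ C₁ := by positivity
  have hC₂0 : 0 ≤ C₂ := by positivity
  refine ⟨C₁ + C₂, by positivity, fun φ hφ hN => ?_⟩
  have key1 : ∀ h s, 0 ≤ h → 0 ≤ s → s ≤ T →
      ‖S h (semigroupConv S φ s) - semigroupConv S φ s‖ ≤ C₁ * h ^ δ := by
    intro h s hh hs hsT
    have hint := intervalIntegrable_semigroup_apply hS hφ hN hs hsT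
    have e1 : S h (semigroupConv S φ s) - semigroupConv S φ s =
        ∫ r in (0 : ℝ)..s, (S h - ContinuousLinearMap.id ℝ V) (S (s - r) (φ r)) :=
      ((S h - ContinuousLinearMap.id ℝ V).intervalIntegral_comp_comm hint).symm
    have hi := (intervalIntegrable_rsub_rpow (by linarith : -1 < -δ) 0 s s).const_mul (N * h ^ δ)
    rw [e1]
    refine (norm_intervalIntegral_le_of_Ioo hs (fun r hr => ?_) hi).trans ?_
    · have hr' : 0 < s - r := sub_pos.2 hr.2
      have h1 : ‖(S h - ContinuousLinearMap.id ℝ V).comp (S (s - r))‖ ≤ h ^ δ * (s - r) ^ (-δ) := by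
        rw [hS.sub_id_comp hh hr'.le]
        exact hS.smoothing δ h _ hδ0 hδ1.le hh hr'
      have h2 := ((S h - ContinuousLinearMap.id ℝ V).comp (S (s - r))).le_opNorm (φ r)
      refine h2.trans ((mul_le_mul h1 (hN r hr.1.le (hr.2.le.trans hsT)) (norm_nonneg _)
        (by positivity)).trans_eq ?_)
      ring
    · rw [intervalIntegral.integral_const_mul, integral_rsub_rpow (by linarith), sub_zero,
        show -δ + 1 = 1 - δ by ring, hC₁, mul_right_comm]
      gcongr
  refine ⟨fun h s hh hs hsT => (key1 h s hh hs hsT).trans ?_, fun s t hs hst ht => ?_⟩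
  · gcongr
    linarith
  have hh : 0 < t - s := sub_pos.2 hst
  have it := intervalIntegrable_semigroup_apply hS hφ hN (hs.trans hst.le) ht
  have is := intervalIntegrable_semigroup_apply hS hφ hN hs (hst.le.trans ht)
  have it1 := it.mono_set (uIcc_subset_uIcc left_mem_uIcc (mem_uIcc_of_le hs hst.le))
  have it2 := it.mono_set (uIcc_subset_uIcc (mem_uIcc_of_le hs hst.le) right_mem_uIcc)
  have e1 : semigroupConv S φ t - semigroupConv S φ s =
      (S (t - s) (semigroupConv S φ s) - semigroupConv S φ s) +
        ∫ r in s..t, S (t - r) (φ r) := by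
    have e2 : ∫ r in (0 : ℝ)..s, S (t - r) (φ r) = S (t - s) (semigroupConv S φ s) := by
      rw [semigroupConv, ← (S (t - s)).intervalIntegral_comp_comm is]
      refine intervalIntegral_congr_Ioo hs fun r hr => ?_
      rw [show t - r = (t - s) + (s - r) by ring, hS.add _ _ hh.le (sub_nonneg.2 hr.2.le)]
      rfl
    rw [semigroupConv, ← intervalIntegral.integral_add_adjacent_intervals it1 it2, e2]
    abel
  have key2 : ‖∫ r in s..t, S (t - r) (φ r)‖ ≤ C₂ * (t - s) ^ δ := by
    refine (norm_intervalIntegral_le_of_Ioo hst.le (g := fun _ => N) (fun r hr => ?_)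
      intervalIntegrable_const).trans ?_
    · exact (hS.norm_apply_le (sub_nonneg.2 hr.2.le) _).trans
        (hN r (hs.trans hr.1.le) (hr.2.le.trans ht))
    · rw [intervalIntegral.integral_const, smul_eq_mul, mul_comm, hC₂, mul_assoc]
      have := rpow_le_rpow_mul (a := 1) (b := δ) hh (by linarith : t - s ≤ T) hδ1.le
      rw [Real.rpow_one] at this
      gcongr
  rw [e1, add_mul]
  exact (norm_add_le _ _).trans (add_le_add (key1 _ s hh.le hs (by linarith)) key2)

/-! ### Compactness -/

theorem tendsto_mul_rpow_zero {δ : ℝ} (hδ : 0 < δ) (C : ℝ) :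
    Tendsto (fun x : ℝ => C * x ^ δ) (𝓝 0) (𝓝 0) := by
  have h1 : Tendsto (fun h : ℝ => C * h ^ δ) (𝓝 0) (𝓝 (C * 0 ^ δ)) :=
    ((Real.continuous_rpow_const hδ.le).tendsto 0).const_mul C
  rwa [Real.zero_rpow hδ.ne', mul_zero] at h1

/-- Each element is within `C * h ^ δ` of its image under `S h`, and `S h` sends the ball of radius
`C'` into a compact set. A finite net of the latter is a net of the whole set once `h` is small. -/
theorem isCompact_setOf_semigroup_approx (hS : IsSmoothingSemigroup S) {δ : ℝ} (hδ : 0 < δ)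
    (C C' : ℝ) : IsCompact {v : V | ‖v‖ ≤ C' ∧ ∀ h, 0 < h → ‖S h v - v‖ ≤ C * h ^ δ} := by
  refine TotallyBounded.isCompact_of_isClosed ?_ ?_
  · refine Metric.totallyBounded_iff.2 fun ε hε => ?_
    have hlim : Tendsto (fun h : ℝ => C * h ^ δ) (𝓝[>] 0) (𝓝 0) :=
      (tendsto_mul_rpow_zero hδ C).mono_left nhdsWithin_le_nhds
    obtain ⟨h, hh1, hh0⟩ := ((hlim.eventually_lt_const (half_pos hε)).and
      self_mem_nhdsWithin).exists
    obtain ⟨K, hK, hSK⟩ := (hS.compact h hh0).image_closedBall_subset_compact C'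
    obtain ⟨t, ht, hKt⟩ := Metric.totallyBounded_iff.1 hK.totallyBounded (ε / 2) (half_pos hε)
    refine ⟨t, ht, fun v hv => ?_⟩
    have h2 := hKt (hSK (mem_image_of_mem (S h) (mem_closedBall_zero_iff.2 hv.1)))
    simp only [mem_iUnion, Metric.mem_ball, exists_prop] at h2 ⊢
    obtain ⟨y, hy, hvy⟩ := h2
    refine ⟨y, hy, ?_⟩
    have h3 : dist v (S h v) < ε / 2 := by
      rw [dist_comm, dist_eq_norm]
      exact (hv.2 h hh0).trans_lt hh1
    linarith [dist_triangle v (S h v) y]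
  · simp only [ofPred_and, ofPred_forall]
    refine (isClosed_le continuous_norm continuous_const).inter ?_
    exact isClosed_iInter fun h => isClosed_iInter fun _ =>
      isClosed_le (((S h).continuous.sub continuous_id).norm) continuous_const

end Regularity

/-! ### Compactness and maps in Hölder spaces -/

section HolderCompactness

variable {V : Type*} [NormedAddCommGroup V] {T β κ δ C : ℝ}

/-- Hölder continuous functions with exponent `δ` lie in `C^β` for `β ≤ δ`. -/
theorem holderQuotient_le_of_holder (hβδ : β ≤ δ) (hC : 0 ≤ C) {f : C(Icc (0 : ℝ) T, V)}
    (hf : ∀ s t : Icc (0 : ℝ) T, s < t → ‖f t - f s‖ ≤ C * ((t : ℝ) - s) ^ δ)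
    (p : {p : Icc (0 : ℝ) T × Icc (0 : ℝ) T // p.1 < p.2}) :
    holderQuotient β 0 f p ≤ C * T ^ (δ - β) := by
  have h : 0 < (p.1.2 : ℝ) - p.1.1 := sub_pos.2 p.2
  have hT : (p.1.2 : ℝ) - p.1.1 ≤ T := by linarith [p.1.2.2.2, p.1.1.2.1]
  rw [holderQuotient, Real.rpow_zero, one_mul, div_le_iff₀ (by positivity), mul_assoc]
  refine (hf _ _ p.2).trans ?_
  gcongr
  exact rpow_le_rpow_mul h hT hβδ

theorem le_rpow_mul_rpow_of_le {a x y l : ℝ} (ha : 0 ≤ a) (hl0 : 0 ≤ l) (hl1 : l ≤ 1) (hx : a ≤ x)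
    (hy : a ≤ y) : a ≤ x ^ (1 - l) * y ^ l := by
  calc a = a ^ (1 - l) * a ^ l := by
        rw [← Real.rpow_add' ha (by norm_num)]
        simp
    _ ≤ x ^ (1 - l) * y ^ l := by
        have : 0 ≤ x := ha.trans hx
        gcongr

/-- The interpolation inequality between the supremum norm and a stronger Hölder norm. -/
theorem holderQuotient_sub_le (hβ : 0 ≤ β) (hβδ : β < δ) (hC : 0 ≤ C) {f g : C(Icc (0 : ℝ) T, V)}
    (hf : ∀ s t : Icc (0 : ℝ) T, s < t → ‖f t - f s‖ ≤ C * ((t : ℝ) - s) ^ δ)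
    (hg : ∀ s t : Icc (0 : ℝ) T, s < t → ‖g t - g s‖ ≤ C * ((t : ℝ) - s) ^ δ)
    (p : {p : Icc (0 : ℝ) T × Icc (0 : ℝ) T // p.1 < p.2}) :
    holderQuotient β 0 (f - g) p ≤ (2 * ‖f - g‖) ^ (1 - β / δ) * (2 * C) ^ (β / δ) := by
  have hδ : 0 < δ := hβ.trans_lt hβδ
  have h : 0 < (p.1.2 : ℝ) - p.1.1 := sub_pos.2 p.2
  have h1 : ‖(f - g) p.1.2 - (f - g) p.1.1‖ ≤ 2 * ‖f - g‖ := by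
    have := norm_sub_le ((f - g) p.1.2) ((f - g) p.1.1)
    linarith [(f - g).norm_coe_le_norm p.1.1, (f - g).norm_coe_le_norm p.1.2]
  have h2 : ‖(f - g) p.1.2 - (f - g) p.1.1‖ ≤ 2 * C * ((p.1.2 : ℝ) - p.1.1) ^ δ := by
    rw [ContinuousMap.sub_apply, ContinuousMap.sub_apply, sub_sub_sub_comm]
    have := norm_sub_le (f p.1.2 - f p.1.1) (g p.1.2 - g p.1.1)
    linarith [hf _ _ p.2, hg _ _ p.2]
  have h3 := le_rpow_mul_rpow_of_le (norm_nonneg _) (by positivity : 0 ≤ β / δ)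
    ((div_le_one hδ).2 hβδ.le) h1 h2
  rw [holderQuotient, Real.rpow_zero, one_mul, div_le_iff₀ (by positivity), mul_assoc]
  rwa [Real.mul_rpow (x := 2 * C) (by positivity) (by positivity), ← Real.rpow_mul h.le,
    mul_div_cancel₀ _ hδ.ne'] at h3

theorem dist_le_of_holder (hδ : 0 < δ) {f : Icc (0 : ℝ) T → V}
    (hf : ∀ s t : Icc (0 : ℝ) T, s < t → ‖f t - f s‖ ≤ C * ((t : ℝ) - s) ^ δ)
    (s t : Icc (0 : ℝ) T) : dist (f s) (f t) ≤ C * dist s t ^ δ := by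
  rcases lt_trichotomy s t with h | rfl | h
  · rw [dist_comm, dist_eq_norm, dist_comm s t, Subtype.dist_eq, Real.dist_eq,
      abs_of_pos (sub_pos.2 (show (s : ℝ) < t from h))]
    exact hf s t h
  · simp [Real.zero_rpow hδ.ne']
  · rw [dist_eq_norm, Subtype.dist_eq, Real.dist_eq,
      abs_of_pos (sub_pos.2 (show (t : ℝ) < s from h))]
    exact hf t s h

theorem continuous_of_holder (hδ : 0 < δ) {f : Icc (0 : ℝ) T → V}
    (hf : ∀ s t : Icc (0 : ℝ) T, s < t → ‖f t - f s‖ ≤ C * ((t : ℝ) - s) ^ δ) : Continuous f := by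
  refine continuous_iff_continuousAt.2 fun t => ?_
  refine tendsto_iff_dist_tendsto_zero.2 (squeeze_zero (fun _ => dist_nonneg)
    (fun s => dist_le_of_holder hδ hf s t) ((tendsto_mul_rpow_zero hδ C).comp ?_))
  exact tendsto_iff_dist_tendsto_zero.1 tendsto_id

theorem isCompact_setOf_holder_range (hδ : 0 < δ) {Q : Set V} (hQ : IsCompact Q) :
    IsCompact {f : C(Icc (0 : ℝ) T, V) |
      (∀ s t : Icc (0 : ℝ) T, s < t → ‖f t - f s‖ ≤ C * ((t : ℝ) - s) ^ δ) ∧ ∀ t, f t ∈ Q} := by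
  refine ArzelaAscoli.isCompact_of_equicontinuous _ ?_ ?_
  · have himage : ContinuousMap.toFun '' {f : C(Icc (0 : ℝ) T, V) |
        (∀ s t : Icc (0 : ℝ) T, s < t → ‖f t - f s‖ ≤ C * ((t : ℝ) - s) ^ δ) ∧ ∀ t, f t ∈ Q} =
        {f | ∀ s t : Icc (0 : ℝ) T, s < t → ‖f t - f s‖ ≤ C * ((t : ℝ) - s) ^ δ} ∩
          Set.pi univ fun _ => Q := by
      ext f
      constructor
      · rintro ⟨f, hf, rfl⟩
        exact ⟨hf.1, fun t _ => hf.2 t⟩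
      · rintro ⟨hf1, hf2⟩
        exact ⟨⟨f, continuous_of_holder hδ hf1⟩, ⟨hf1, fun t => hf2 t (mem_univ t)⟩, rfl⟩
    rw [himage]
    refine (isCompact_univ_pi fun _ => hQ).inter_left ?_
    simp only [ofPred_forall]
    exact isClosed_iInter fun s => isClosed_iInter fun t => isClosed_iInter fun _ =>
      isClosed_le ((continuous_apply t).sub (continuous_apply s)).norm continuous_const
  · refine Metric.equicontinuous_of_continuity_modulus (fun x => C * x ^ δ) (tendsto_mul_rpow_zero hδ C)
      _ ?_
    rintro s t ⟨f, hf⟩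
    exact dist_le_of_holder hδ hf.1 s t

variable [NormedSpace ℝ V]

theorem WeightedHolderSpace.norm_eq (u : WeightedHolderSpace T β κ V) :
    ‖u‖ = ‖u.toContinuousMap‖ + holderSeminorm β κ u.toContinuousMap := rfl

theorem WeightedHolderSpace.toContinuousMap_sub (u v : WeightedHolderSpace T β κ V) :
    (u - v).toContinuousMap = u.toContinuousMap - v.toContinuousMap := rfl

theorem WeightedHolderSpace.toContinuousMap_injective :
    Function.Injective (toContinuousMap : WeightedHolderSpace T β κ V → _) :=
  Subtype.val_injective

theorem WeightedHolderSpace.path_apply (hT : 0 ≤ T) (u : WeightedHolderSpace T β κ V) {t : ℝ}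
    (ht : t ∈ Icc 0 T) : u.path hT t = u.toContinuousMap ⟨t, ht⟩ :=
  IccExtend_of_mem hT _ ht

theorem WeightedHolderSpace.continuous_path (hT : 0 ≤ T) (u : WeightedHolderSpace T β κ V) :
    Continuous (u.path hT) :=
  u.toContinuousMap.continuous.Icc_extend'

theorem WeightedHolderSpace.norm_apply_le (u : WeightedHolderSpace T β κ V) (t : Icc (0 : ℝ) T) :
    ‖u.toContinuousMap t‖ ≤ ‖u‖ := by
  have h : 0 ≤ holderSeminorm β κ u.toContinuousMap := Real.iSup_nonneg (holderQuotient_nonneg β κ _)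
  rw [u.norm_eq]
  linarith [u.toContinuousMap.norm_coe_le_norm t]

theorem WeightedHolderSpace.holderQuotient_le (u : WeightedHolderSpace T β κ V)
    (p : {p : Icc (0 : ℝ) T × Icc (0 : ℝ) T // p.1 < p.2}) :
    holderQuotient β κ u.toContinuousMap p ≤ ‖u‖ := by
  have h : holderQuotient β κ u.toContinuousMap p ≤ holderSeminorm β κ u.toContinuousMap :=
    le_ciSup u.2 p
  rw [u.norm_eq]
  linarith [norm_nonneg u.toContinuousMap]

theorem WeightedHolderSpace.norm_le {u : WeightedHolderSpace T β κ V} {a b : ℝ}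
    (hb0 : 0 ≤ b) (ha : ‖u.toContinuousMap‖ ≤ a)
    (hb : ∀ p, holderQuotient β κ u.toContinuousMap p ≤ b) : ‖u‖ ≤ a + b := by
  rw [u.norm_eq]
  exact add_le_add ha (Real.iSup_le hb hb0)

theorem WeightedHolderSpace.norm_path_le (hT : 0 ≤ T) {R : ℝ} {u : WeightedHolderSpace T β κ V}
    (hu : u ∈ Metric.closedBall 0 R) {t : ℝ} (ht : t ∈ Icc 0 T) : ‖u.path hT t‖ ≤ R := by
  rw [u.path_apply hT ht]
  exact (u.norm_apply_le _).trans (mem_closedBall_zero_iff.1 hu)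

theorem WeightedHolderSpace.rpow_mul_norm_path_sub_le (hT : 0 ≤ T) {R : ℝ}
    {u : WeightedHolderSpace T β κ V} (hu : u ∈ Metric.closedBall 0 R) {s t : ℝ} (hs : 0 ≤ s)
    (hst : s < t) (ht : t ≤ T) :
    s ^ κ * ‖u.path hT t - u.path hT s‖ ≤ R * (t - s) ^ β := by
  have hs' : s ∈ Icc 0 T := ⟨hs, hst.le.trans ht⟩
  have ht' : t ∈ Icc 0 T := ⟨hs.trans hst.le, ht⟩
  have h := (u.holderQuotient_le ⟨(⟨s, hs'⟩, ⟨t, ht'⟩), hst⟩).trans (mem_closedBall_zero_iff.1 hu)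
  simp only [holderQuotient] at h
  rwa [u.path_apply hT hs', u.path_apply hT ht', ← div_le_iff₀
    (Real.rpow_pos_of_pos (sub_pos.2 hst) β), mul_div_assoc]

/-- Functions with values in a fixed compact set that are uniformly `δ`-Hölder continuous form a
compact subset of `C^β` for `β < δ`. -/
theorem isCompact_setOf_holderSpace (hβ : 0 ≤ β) (hβδ : β < δ) (hC : 0 ≤ C) {Q : Set V}
    (hQ : IsCompact Q) : IsCompact {y : HolderSpace T β V |
      (∀ s t : Icc (0 : ℝ) T, s < t →
        ‖y.toContinuousMap t - y.toContinuousMap s‖ ≤ C * ((t : ℝ) - s) ^ δ) ∧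
      ∀ t, y.toContinuousMap t ∈ Q} := by
  have hδ : 0 < δ := hβ.trans_lt hβδ
  set K := {f : C(Icc (0 : ℝ) T, V) |
      (∀ s t : Icc (0 : ℝ) T, s < t → ‖f t - f s‖ ≤ C * ((t : ℝ) - s) ^ δ) ∧ ∀ t, f t ∈ Q} with hK
  have hKc : CompactSpace K := isCompact_iff_compactSpace.1 (isCompact_setOf_holder_range hδ hQ)
  let Φ : K → HolderSpace T β V := fun f => ⟨f.1, C * T ^ (δ - β), by
    rintro _ ⟨p, rfl⟩
    exact holderQuotient_le_of_holder hβδ.le hC f.2.1 p⟩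
  have hΦ : ∀ f, (Φ f).toContinuousMap = f.1 := fun f => rfl
  have hcont : Continuous Φ := by
    refine continuous_iff_continuousAt.2 fun g => ?_
    refine tendsto_iff_norm_sub_tendsto_zero.2 ?_
    have h1 : Tendsto (fun f : K => ‖f.1 - g.1‖) (𝓝 g) (𝓝 0) :=
      tendsto_iff_norm_sub_tendsto_zero.1 (continuous_subtype_val.tendsto g)
    have hl : 0 < 1 - β / δ := sub_pos.2 ((div_lt_one hδ).2 hβδ)
    -- By interpolation the `C^β` distance is controlled by the supremum distance, with exponent `1
    -- - β / δ > 0`.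
    have h2 : Tendsto (fun f : K => ‖f.1 - g.1‖ +
        (2 * ‖f.1 - g.1‖) ^ (1 - β / δ) * (2 * C) ^ (β / δ)) (𝓝 g) (𝓝 0) := by
      have h3 : Tendsto (fun x : ℝ => x + (2 * x) ^ (1 - β / δ) * (2 * C) ^ (β / δ)) (𝓝 0)
          (𝓝 (0 + (2 * 0) ^ (1 - β / δ) * (2 * C) ^ (β / δ))) := by
        refine Continuous.tendsto ?_ 0
        exact continuous_id.add
          (((Real.continuous_rpow_const hl.le).comp (continuous_const.mul continuous_id)).mul_const _)
      rw [mul_zero, Real.zero_rpow hl.ne', zero_mul, add_zero] at h3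
      exact h3.comp h1
    refine squeeze_zero (fun _ => norm_nonneg _) (fun f => ?_) h2
    refine WeightedHolderSpace.norm_le (by positivity) ?_ fun p => ?_
    · rw [WeightedHolderSpace.toContinuousMap_sub]
      exact le_rfl
    · rw [WeightedHolderSpace.toContinuousMap_sub]
      exact holderQuotient_sub_le hβ hβδ hC f.2.1 g.2.1 p
  have himage : {y : HolderSpace T β V | (∀ s t : Icc (0 : ℝ) T, s < t →
        ‖y.toContinuousMap t - y.toContinuousMap s‖ ≤ C * ((t : ℝ) - s) ^ δ) ∧
      ∀ t, y.toContinuousMap t ∈ Q} = range Φ := by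
    ext y
    constructor
    · intro hy
      exact ⟨⟨y.toContinuousMap, hy⟩, WeightedHolderSpace.toContinuousMap_injective (hΦ _)⟩
    · rintro ⟨f, rfl⟩
      exact f.2
  rw [himage]
  exact isCompact_range hcont

/-- The inclusion of `C^β` into `C^β_β`. -/
def HolderSpace.toSingular (hβ : 0 ≤ β) (u : HolderSpace T β V) : SingularHolderSpace T β V :=
  ⟨u.toContinuousMap, T ^ β * ‖u‖, by
    rintro _ ⟨p, rfl⟩
    have h := u.holderQuotient_le p
    have h0 : (0 : ℝ) ≤ p.1.1 := p.1.1.2.1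
    rw [holderQuotient, Real.rpow_zero, one_mul] at h
    rw [holderQuotient]
    have h1 : (0 : ℝ) ≤ (p.1.2 : ℝ) - p.1.1 := sub_nonneg.2 (le_of_lt p.2)
    have hT : (0 : ℝ) ≤ T := h0.trans p.1.1.2.2
    exact mul_le_mul (Real.rpow_le_rpow h0 p.1.1.2.2 hβ) h (by positivity) (by positivity)⟩

theorem HolderSpace.toSingular_sub (hβ : 0 ≤ β) (u v : HolderSpace T β V) :
    u.toSingular hβ - v.toSingular hβ = (u - v).toSingular hβ := rfl

theorem HolderSpace.norm_toSingular_le (hT : 0 ≤ T) (hβ : 0 ≤ β) (u : HolderSpace T β V) :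
    ‖u.toSingular hβ‖ ≤ (1 + T ^ β) * ‖u‖ := by
  rw [add_mul, one_mul]
  refine WeightedHolderSpace.norm_le (by positivity)
    ((ContinuousMap.norm_le _ (norm_nonneg _)).2 fun t => u.norm_apply_le t) fun p => ?_
  have h := u.holderQuotient_le p
  have h0 : (0 : ℝ) ≤ p.1.1 := p.1.1.2.1
  have h1 : (0 : ℝ) ≤ (p.1.2 : ℝ) - p.1.1 := sub_nonneg.2 (le_of_lt p.2)
  rw [holderQuotient, Real.rpow_zero, one_mul] at h
  rw [holderQuotient]
  exact mul_le_mul (Real.rpow_le_rpow h0 p.1.1.2.2 hβ) h (by positivity) (by positivity)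

theorem HolderSpace.continuous_toSingular (hT : 0 ≤ T) (hβ : 0 ≤ β) :
    Continuous (toSingular hβ : HolderSpace T β V → SingularHolderSpace T β V) := by
  refine (LipschitzWith.of_dist_le_mul (K := (1 + T ^ β).toNNReal) fun u v => ?_).continuous
  rw [Real.coe_toNNReal _ (by positivity), dist_eq_norm, dist_eq_norm, toSingular_sub]
  exact norm_toSingular_le hT hβ _

/-! #### Orbits of the semigroup -/

variable {S : ℝ → V →L[ℝ] V}

/-- The singularity `s ^ (-β)` of the smoothing estimate is exactly cancelled by the weight, and
pairs with `s = 0` contribute nothing. An orbit of a general `v` need not lie in the unweighted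
space. -/
theorem IsSmoothingSemigroup.holderQuotient_orbit_le (hS : IsSmoothingSemigroup S) (hβ0 : 0 < β)
    (hβ1 : β ≤ 1) {f : C(Icc (0 : ℝ) T, V)} {v : V} (hf : ∀ t, f t = S t v)
    (p : {p : Icc (0 : ℝ) T × Icc (0 : ℝ) T // p.1 < p.2}) : holderQuotient β β f p ≤ ‖v‖ := by
  have h1 : 0 < (p.1.2 : ℝ) - p.1.1 := sub_pos.2 p.2
  rcases p.1.1.2.1.eq_or_lt with h0 | h0
  · rw [holderQuotient, ← h0, Real.zero_rpow hβ0.ne', zero_mul]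
    exact norm_nonneg v
  · have h2 : 0 < ((p.1.1 : ℝ)) ^ β := Real.rpow_pos_of_pos h0 β
    rw [holderQuotient, ← mul_div_assoc, div_le_iff₀ (by positivity), hf, hf,
      ← _root_.sub_apply]
    have h3 := (S p.1.2 - S p.1.1).le_of_opNorm_le
      (hS.norm_sub_le hβ0.le hβ1 h0 (le_of_lt p.2)) v
    calc (p.1.1 : ℝ) ^ β * ‖(S p.1.2 - S p.1.1) v‖
        ≤ (p.1.1 : ℝ) ^ β * (((p.1.2 : ℝ) - p.1.1) ^ β * (p.1.1 : ℝ) ^ (-β) * ‖v‖) := by gcongr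
      _ = ‖v‖ * ((p.1.2 : ℝ) - p.1.1) ^ β := by
        rw [Real.rpow_neg h0.le]
        field_simp

/-- The orbit `t ↦ S t v` as an element of `C^β_β`. -/
def IsSmoothingSemigroup.orbit (hS : IsSmoothingSemigroup S) (T : ℝ) (hβ0 : 0 < β) (hβ1 : β ≤ 1)
    (v : V) : SingularHolderSpace T β V :=
  ⟨⟨fun t => S t v, continuousOn_iff_continuous_domRestrict.1
      ((hS.continuousOn v).mono fun _ ht => ht.1)⟩, ‖v‖, by
    rintro _ ⟨p, rfl⟩
    exact hS.holderQuotient_orbit_le hβ0 hβ1 (fun _ => rfl) p⟩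

theorem IsSmoothingSemigroup.orbit_apply (hS : IsSmoothingSemigroup S) (hβ0 : 0 < β) (hβ1 : β ≤ 1)
    (v : V) (t : Icc (0 : ℝ) T) : (hS.orbit T hβ0 hβ1 v).toContinuousMap t = S t v := rfl

theorem IsSmoothingSemigroup.orbit_sub (hS : IsSmoothingSemigroup S) (hβ0 : 0 < β) (hβ1 : β ≤ 1)
    (v w : V) : hS.orbit T hβ0 hβ1 v - hS.orbit T hβ0 hβ1 w = hS.orbit T hβ0 hβ1 (v - w) := by
  refine WeightedHolderSpace.toContinuousMap_injective (ContinuousMap.ext fun t => ?_)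
  rw [WeightedHolderSpace.toContinuousMap_sub, ContinuousMap.sub_apply, orbit_apply, orbit_apply,
    orbit_apply, map_sub]

theorem IsSmoothingSemigroup.continuous_orbit (hS : IsSmoothingSemigroup S) (hβ0 : 0 < β)
    (hβ1 : β ≤ 1) : Continuous (hS.orbit T hβ0 hβ1) := by
  -- Supremum norm and seminorm of the orbit of `v - w` each cost `‖v - w‖`.
  refine (LipschitzWith.of_dist_le_mul (K := 2) fun v w => ?_).continuous
  rw [dist_eq_norm, dist_eq_norm, hS.orbit_sub]
  refine (WeightedHolderSpace.norm_le (norm_nonneg (v - w))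
    ((ContinuousMap.norm_le _ (norm_nonneg (v - w))).2 fun t => ?_) fun p =>
      hS.holderQuotient_orbit_le hβ0 hβ1 (fun _ => rfl) p).trans_eq ?_
  · exact hS.norm_apply_le t.2.1 _
  · rw [NNReal.coe_ofNat]
    ring

end HolderCompactness

/-! ### The mild solution operator -/

theorem isHolder_path {V : Type*} [NormedAddCommGroup V] [NormedSpace ℝ V] {θ R T : ℝ}
    (hT : 0 ≤ T) (hR : 0 ≤ R) {ω : HolderSpace T θ V} (hω : ω ∈ Metric.closedBall 0 R) :
    IsHolder θ R T (ω.path hT) where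
  continuous := ω.continuous_path hT
  nonneg := hR
  holder q r hq hqr hr := by
    rcases hqr.eq_or_lt with rfl | hqr
    · rw [sub_self, norm_zero, sub_self]
      have := Real.rpow_nonneg (le_refl (0 : ℝ)) θ
      positivity
    have h1 := WeightedHolderSpace.rpow_mul_norm_path_sub_le hT hω hq hqr hr
    rwa [Real.rpow_zero, one_mul, norm_sub_rev] at h1

section MildOperator

variable {V : Type*} [NormedAddCommGroup V] [InnerProductSpace ℝ V]
  {S : ℝ → V →L[ℝ] V} {ι : Type*} {e : HilbertBasis ι ℝ V} {F : V → V} {G : V → V →L[ℝ] V}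
  {α β θ M R T LG : ℝ} {u ω : ℝ → V}

theorem isSingularHolder_comp (hG : ∀ x y, ‖G x - G y‖ ≤ |LG| * ‖x - y‖) (hT : 0 ≤ T) (hR : 0 ≤ R)
    {u : SingularHolderSpace T β V} (hu : u ∈ Metric.closedBall 0 R) :
    IsSingularHolder β (‖G 0‖ + |LG| * R) T (fun r => G (u.path hT r)) where
  continuous := by
    have : LipschitzWith (Real.toNNReal |LG|) G := LipschitzWith.of_dist_le_mul fun x y => by
      rw [Real.coe_toNNReal _ (abs_nonneg _), dist_eq_norm, dist_eq_norm]
      exact hG x y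
    exact this.continuous.comp (u.continuous_path hT)
  nonneg := by positivity
  bound r h0 h1 := by
    have h2 := WeightedHolderSpace.norm_path_le hT hu ⟨h0, h1⟩
    have h3 := hG (u.path hT r) 0
    rw [sub_zero] at h3
    calc ‖G (u.path hT r)‖ = ‖G 0 + (G (u.path hT r) - G 0)‖ := by rw [add_sub_cancel]
      _ ≤ ‖G 0‖ + |LG| * ‖u.path hT r‖ := (norm_add_le _ _).trans (by gcongr)
      _ ≤ ‖G 0‖ + |LG| * R := by gcongr
  holder q r hq hqr hr := by
    rcases hqr.eq_or_lt with rfl | hqr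
    · rw [sub_self, norm_zero, sub_self]
      have := Real.rpow_nonneg (le_refl (0 : ℝ)) β
      positivity
    have h1 := WeightedHolderSpace.rpow_mul_norm_path_sub_le hT hu hq.le hqr hr
    have hqb : 0 < q ^ β := Real.rpow_pos_of_pos hq β
    have h2 : ‖u.path hT r - u.path hT q‖ ≤ R * (q ^ (-β) * (r - q) ^ β) := by
      rw [Real.rpow_neg hq.le, ← mul_le_mul_iff_right₀ hqb]
      refine h1.trans_eq ?_
      field_simp
    have h3 : 0 ≤ r - q := sub_nonneg.2 hqr.le
    calc ‖G (u.path hT r) - G (u.path hT q)‖ ≤ |LG| * ‖u.path hT r - u.path hT q‖ := hG _ _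
      _ ≤ |LG| * (R * (q ^ (-β) * (r - q) ^ β)) := by gcongr
      -- Added only so that one constant bounds both the size and the seminorm.
      _ ≤ ‖G 0‖ * (q ^ (-β) * (r - q) ^ β) + |LG| * (R * (q ^ (-β) * (r - q) ^ β)) :=
        le_add_of_nonneg_left (by positivity)
      _ = _ := by ring

variable [CompleteSpace V]

theorem norm_sub_le_of_hilbertSchmidt (hG : ∀ x, IsHilbertSchmidt e (G x))
    (hGlip : ∀ x y, hilbertSchmidtNorm e (G x - G y) ≤ LG * ‖x - y‖) (x y : V) :
    ‖G x - G y‖ ≤ |LG| * ‖x - y‖ :=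
  (opNorm_le_hilbertSchmidtNorm e ((hG x).sub (hG y))).trans ((hGlip x y).trans
    (mul_le_mul_of_nonneg_right (le_abs_self LG) (norm_nonneg _)))

/-- The minus sign is the product of the two phases. -/
theorem mildIntegralOp_eq [Countable ι] (hS : IsSmoothingSemigroup S)
    (hH : IsSingularHolder β M T (fun r => G (u r))) (hω : IsHolder θ R T ω) (hα0 : 0 < α)
    (hαβ : α < β) (hβ : β < 1) (hα : 1 < θ + α) {t : ℝ} (ht0 : 0 ≤ t) (ht : t ≤ T) :
    mildIntegralOp e α S F G u ω t =
      semigroupConv S (fun r => F (u r)) t - fracConv S (fun r => G (u r)) α ω t := by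
  rw [sub_eq_add_neg]
  exact congrArg _ ((fracIntegrable_convIntegrand hS hH hω hα0 hαβ hβ hα ht0 ht).pathwiseIntegral_eq
    ht0 e)

end MildOperator

theorem theoremt3 {V : Type*} [NormedAddCommGroup V] [InnerProductSpace ℝ V] [CompleteSpace V]
    [TopologicalSpace.SeparableSpace V]
    (A : V →ₗ.[ℝ] V) (hA : IsNegPosSymmCompactInv A)
    (S : ℝ → V →L[ℝ] V) (hS : IsSemigroupGeneratedBy S A)
    {ι : Type*} (e : HilbertBasis ι ℝ V) (lam : ι → ℝ) (he : IsEigenbasis e lam A)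
    (F : V → V) (hF : Continuous F) (cF LF : ℝ) (hFgrowth : ∀ x, ‖F x‖ ≤ cF + LF * ‖x‖)
    (G : V → V →L[ℝ] V) (hG : ∀ x, IsHilbertSchmidt e (G x))
    (LG : ℝ) (hGlip : ∀ x y, hilbertSchmidtNorm e (G x - G y) ≤ LG * ‖x - y‖)
    (α β β' : ℝ) (hβ : 1 / 2 < β) (hββ' : β < β') (hβ' : β' < 1)
    (hα : 1 - β' < α) (hαβ : α < β)
    (T : ℝ) (hT : 0 < T) (R : ℝ) (𝒦 : Set V) (h𝒦 : IsCompact 𝒦) :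
    -- all integrals are well defined
    (∀ u ∈ Metric.closedBall (0 : SingularHolderSpace T β V) R,
      ∀ ω ∈ Metric.closedBall (0 : HolderSpace T β' V) R, ∀ t ∈ Icc 0 T,
        MildIntegrable e α S F G (u.path hT.le) (ω.path hT.le) t) ∧
    -- `𝒯^I` maps into `C^β`, with relatively compact image
    (∀ u ∈ Metric.closedBall (0 : SingularHolderSpace T β V) R,
      ∀ ω ∈ Metric.closedBall (0 : HolderSpace T β' V) R,
        ∃ y : HolderSpace T β V, ∀ t ∈ Icc 0 T,
          y.path hT.le t = mildIntegralOp e α S F G (u.path hT.le) (ω.path hT.le) t) ∧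
    IsCompact (closure {y : HolderSpace T β V |
      ∃ u ∈ Metric.closedBall (0 : SingularHolderSpace T β V) R,
        ∃ ω ∈ Metric.closedBall (0 : HolderSpace T β' V) R, ∀ t ∈ Icc 0 T,
          y.path hT.le t = mildIntegralOp e α S F G (u.path hT.le) (ω.path hT.le) t}) ∧
    -- `𝒯` maps into `C^β_β`, with relatively compact image
    (∀ u ∈ Metric.closedBall (0 : SingularHolderSpace T β V) R,
      ∀ ω ∈ Metric.closedBall (0 : HolderSpace T β' V) R, ∀ u₀ ∈ 𝒦,
        ∃ y : SingularHolderSpace T β V, ∀ t ∈ Icc 0 T,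
          y.path hT.le t = mildOp e α S F G (u.path hT.le) (ω.path hT.le) u₀ t) ∧
    IsCompact (closure {y : SingularHolderSpace T β V |
      ∃ u ∈ Metric.closedBall (0 : SingularHolderSpace T β V) R,
        ∃ ω ∈ Metric.closedBall (0 : HolderSpace T β' V) R, ∃ u₀ ∈ 𝒦, ∀ t ∈ Icc 0 T,
          y.path hT.le t = mildOp e α S F G (u.path hT.le) (ω.path hT.le) u₀ t}) := by
  have hSm : IsSmoothingSemigroup S := hS.isSmoothingSemigroup hA he
  have hι : Countable ι := e.countable
  have hα0 : 0 < α := by linarith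
  have hβ0 : 0 < β := by linarith
  have hβ1 : β < 1 := by linarith
  have hθα : 1 < β' + α := by linarith
  have hG' := norm_sub_le_of_hilbertSchmidt hG hGlip
  have hF' : ∀ u ∈ Metric.closedBall (0 : SingularHolderSpace T β V) R, ∀ r, 0 ≤ r → r ≤ T →
      ‖F (u.path hT.le r)‖ ≤ |cF| + |LF| * |R| := by
    intro u hu r h0 h1
    have h2 := (WeightedHolderSpace.norm_path_le hT.le hu ⟨h0, h1⟩).trans (le_abs_self R)
    refine (hFgrowth _).trans (add_le_add (le_abs_self cF) ?_)
    exact mul_le_mul (le_abs_self LF) h2 (norm_nonneg _) (abs_nonneg _)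
  -- The radius may be negative, with empty balls; constants are built from `|R|`, which equals `R`
  -- as soon as a ball has an element.
  have hball : ∀ u ∈ Metric.closedBall (0 : SingularHolderSpace T β V) R, 0 ≤ R :=
    fun u hu => (norm_nonneg u).trans (mem_closedBall_zero_iff.1 hu)
  have hR : ∀ u ∈ Metric.closedBall (0 : SingularHolderSpace T β V) R, |R| = R :=
    fun u hu => abs_of_nonneg (hball u hu)
  have hH : ∀ u ∈ Metric.closedBall (0 : SingularHolderSpace T β V) R,
      IsSingularHolder β (‖G 0‖ + |LG| * |R|) T (fun r => G (u.path hT.le r)) := by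
    intro u hu
    rw [hR u hu]
    exact isSingularHolder_comp hG' hT.le (hball u hu) hu
  have hw : ∀ ω ∈ Metric.closedBall (0 : HolderSpace T β' V) R,
      IsHolder β' |R| T (ω.path hT.le) := by
    intro ω hω
    have h0 : 0 ≤ R := (norm_nonneg ω).trans (mem_closedBall_zero_iff.1 hω)
    rw [abs_of_nonneg h0]
    exact isHolder_path hT.le h0 hω
  -- The first bound keeps `δ = β' - 2ε` at least `(β + β') / 2 > β` and gives `α + ε ≤ 1`; the
  -- second gives `ε ≤ α`.
  set ε : ℝ := min ((β' - β) / 4) (α / 2) with hε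
  have hε0 : 0 < ε := lt_min (by linarith) (by linarith)
  have hε1 : ε ≤ (β' - β) / 4 := min_le_left _ _
  have hε2 : ε ≤ α / 2 := min_le_right _ _
  set δ : ℝ := β' - 2 * ε with hδ
  have hβδ : β < δ := by linarith
  obtain ⟨C₁, hC₁, hreg₁⟩ := exists_hasOrbitRegularity_semigroupConv hSm (δ := δ)
    (N := |cF| + |LF| * |R|) (T := T) (by linarith) (by linarith) (by positivity) hT.le
  obtain ⟨C₂, hC₂, hreg₂⟩ := exists_hasOrbitRegularity_fracConv hSm (α := α) (β := β) (θ := β')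
    (ε := ε) (M := ‖G 0‖ + |LG| * |R|) (R := |R|) (T := T) hα0 hαβ hβ1 hθα hβ'.le hε0
    (by linarith) (by linarith) (by linarith) (by positivity) (abs_nonneg R) hT.le
  have hC : 0 ≤ C₁ + C₂ := add_nonneg hC₁ hC₂
  let J : (ℝ → V) → (ℝ → V) → ℝ → V := fun u ω t =>
    semigroupConv S (fun r => F (u r)) t - fracConv S (fun r => G (u r)) α ω t
  have hJ : ∀ u ∈ Metric.closedBall (0 : SingularHolderSpace T β V) R,
      ∀ ω ∈ Metric.closedBall (0 : HolderSpace T β' V) R, ∀ t ∈ Icc 0 T,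
        mildIntegralOp e α S F G (u.path hT.le) (ω.path hT.le) t =
          J (u.path hT.le) (ω.path hT.le) t := fun u hu ω hω t ht =>
    mildIntegralOp_eq hSm (hH u hu) (hw ω hω) hα0 hαβ hβ1 hθα ht.1 ht.2
  have hreg : ∀ u ∈ Metric.closedBall (0 : SingularHolderSpace T β V) R,
      ∀ ω ∈ Metric.closedBall (0 : HolderSpace T β' V) R,
        HasOrbitRegularity S δ (C₁ + C₂) T (J (u.path hT.le) (ω.path hT.le)) :=
    fun u hu ω hω => (hreg₁ _ (hF.comp (u.continuous_path hT.le)) (hF' u hu)).sub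
      (hreg₂ _ _ (hH u hu) (hw ω hω))
  -- With zero initial value, the supremum bound follows from the Hölder bound.
  have hJ0 : ∀ u ω, J u ω 0 = 0 := fun u ω => by simp [J, semigroupConv, fracConv]
  have hJbound : ∀ u ∈ Metric.closedBall (0 : SingularHolderSpace T β V) R,
      ∀ ω ∈ Metric.closedBall (0 : HolderSpace T β' V) R, ∀ t ∈ Icc 0 T,
        ‖J (u.path hT.le) (ω.path hT.le) t‖ ≤ (C₁ + C₂) * T ^ δ := by
    intro u hu ω hω t ht
    rcases ht.1.eq_or_lt with h | h
    · rw [← h, hJ0, norm_zero]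
      positivity
    · have := (hreg u hu ω hω).holder 0 t le_rfl h ht.2
      rw [hJ0, sub_zero, sub_zero] at this
      refine this.trans ?_
      gcongr
      · linarith
      · exact ht.2
  have hexists : ∀ u ∈ Metric.closedBall (0 : SingularHolderSpace T β V) R,
      ∀ ω ∈ Metric.closedBall (0 : HolderSpace T β' V) R,
        ∃ y : HolderSpace T β V, ∀ t ∈ Icc 0 T,
          y.path hT.le t = mildIntegralOp e α S F G (u.path hT.le) (ω.path hT.le) t := by
    intro u hu ω hω
    have hh := hreg u hu ω hω
    let f : C(Icc (0 : ℝ) T, V) := ⟨fun t => J (u.path hT.le) (ω.path hT.le) t,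
      continuous_of_holder (by linarith : 0 < δ) fun s t hst => hh.holder s t s.2.1 hst t.2.2⟩
    refine ⟨⟨f, (C₁ + C₂) * T ^ (δ - β), ?_⟩, fun t ht => ?_⟩
    · rintro _ ⟨p, rfl⟩
      exact holderQuotient_le_of_holder hβδ.le hC
        (fun s t hst => hh.holder s t s.2.1 hst t.2.2) p
    · exact (WeightedHolderSpace.path_apply hT.le _ ht).trans (hJ u hu ω hω t ht).symm
  have hcompact : IsCompact (closure {y : HolderSpace T β V |
      ∃ u ∈ Metric.closedBall (0 : SingularHolderSpace T β V) R,
        ∃ ω ∈ Metric.closedBall (0 : HolderSpace T β' V) R, ∀ t ∈ Icc 0 T,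
          y.path hT.le t = mildIntegralOp e α S F G (u.path hT.le) (ω.path hT.le) t}) := by
    refine (isCompact_setOf_holderSpace hβ0.le hβδ hC (isCompact_setOf_semigroup_approx hSm
      (by linarith : 0 < δ) (C₁ + C₂) ((C₁ + C₂) * T ^ δ))).closure_of_subset ?_
    rintro y ⟨u, hu, ω, hω, hy⟩
    have hh := hreg u hu ω hω
    have hy' : ∀ t : Icc (0 : ℝ) T, y.toContinuousMap t = J (u.path hT.le) (ω.path hT.le) t := by
      intro t
      rw [← hJ u hu ω hω t t.2, ← hy t t.2, WeightedHolderSpace.path_apply hT.le _ t.2]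
    refine ⟨fun s t hst => ?_, fun t => ⟨?_, fun h hh0 => ?_⟩⟩
    · rw [hy', hy']
      exact hh.holder s t s.2.1 hst t.2.2
    · rw [hy']
      exact hJbound u hu ω hω t t.2
    · rw [hy']
      exact hh.smooth h t hh0.le t.2.1 t.2.2
  refine ⟨fun u hu ω hω t ht => ⟨?_, ?_⟩, hexists, hcompact, fun u hu ω hω u₀ hu₀ => ?_, ?_⟩
  · exact intervalIntegrable_semigroup_apply hSm (hF.comp (u.continuous_path hT.le)) (hF' u hu)
      ht.1 ht.2
  · exact (fracIntegrable_convIntegrand hSm (hH u hu) (hw ω hω) hα0 hαβ hβ1 hθα ht.1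
      ht.2).pathwiseIntegrable ht.1 e
  · obtain ⟨y, hy⟩ := hexists u hu ω hω
    refine ⟨hSm.orbit T hβ0 hβ1.le u₀ + HolderSpace.toSingular hβ0.le y, fun t ht => ?_⟩
    rw [mildOp, ← hy t ht, WeightedHolderSpace.path_apply hT.le _ ht,
      WeightedHolderSpace.path_apply hT.le _ ht]
    rfl
  -- Addition of the orbit and of the embedded integral part is continuous on `𝒦` times the compact
  -- closure just obtained.
  · refine IsCompact.closure_of_subset ((h𝒦.prod hcompact).image
      (((hSm.continuous_orbit (T := T) hβ0 hβ1.le).comp continuous_fst).add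
        ((HolderSpace.continuous_toSingular hT.le hβ0.le).comp continuous_snd))) ?_
    rintro z ⟨u, hu, ω, hω, u₀, hu₀, hz⟩
    obtain ⟨y, hy⟩ := hexists u hu ω hω
    refine ⟨(u₀, y), ⟨hu₀, subset_closure ⟨u, hu, ω, hω, hy⟩⟩, ?_⟩
    refine WeightedHolderSpace.toContinuousMap_injective (ContinuousMap.ext fun t => ?_)
    rw [← WeightedHolderSpace.path_apply hT.le z t.2, hz t t.2, mildOp, ← hy t t.2,
      WeightedHolderSpace.path_apply hT.le y t.2]
    rfl

end
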